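/- Let $\theta\in\mathbb R$ be irrational and $\lambda=e^{2\pi i\theta}$. Let $\mathcal A_\theta$ be the universal $C^*$-algebra generated by two unitaries $U,V$ with $UV=\lambda VU$. Then $\mathcal A_\theta$ has exactly one faithful normalized trace $\tau$. Let $\mathcal H_\tau=L^2(\mathcal A_\theta,\tau)$ be its GNS Hilbert space, and let $U_l,V_l,U_r,V_r$ be the bounded operators on $\mathcal H_\tau$ determined by $$U_la=Ua,\quad V_la=Va,\quad U_ra=aU,\quad V_ra=aV\qquad(a\in\mathcal A_\theta\subseteq\mathcal H_\tau).$$ Let $\mathcal B\subseteq B(\mathcal H_\tau\otimes\mathcal H_\tau)$ be the $C^*$-algebra generated by $U_l\otimes 1,\ V_l\otimes 1,\ 1\otimes U_r,\ 1\otimes V_r$. Then: 1. $\mathcal B$ is isomorphic, as a $C^*$-algebra, to the crossed product $C(\mathbb T^2)\rtimes_\alpha\mathbb Z^2$ for the double rotation action $$\alpha(k_1,k_2)(f)(z_1,z_2)=f(\lambda^{-k_1}z_1,\lambda^{-k_2}z_2).$$ 2. $\mathcal B$ is isomorphic, as a $C^*$-algebra, to the $4$-dimensional noncommutative torus of the skew-symmetric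 matrix $\Theta$ with $\Theta_{12}=\Theta_{34}=\theta$, $\Theta_{21}=\Theta_{43}=-\theta$ and all other entries $0$, that is, to the universal $C^*$-algebra generated by unitaries $u_1,\dots,u_4$ with $u_ju_k=e^{2\pi i\Theta_{jk}}u_ku_j$ for all $j,k$. -/

import Mathlib

open scoped ComplexOrder TensorProduct
open UniformSpace

noncomputable section

/-! ## The free unital `*`-algebra -/

/-- The free unital complex `*`-algebra on a set `X`: the algebra of noncommutative polynomials in
the letters `x` and `x*`, `x ∈ X` (the letter `x` is `Sum.inl x`, the letter `x*` is `Sum.inr x`).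
-/
def FreeStarAlgebra (X : Type) : Type := MonoidAlgebra ℂ (FreeMonoid (X ⊕ X))

namespace FreeStarAlgebra

variable {X : Type}

instance : Ring (FreeStarAlgebra X) := inferInstanceAs (Ring (MonoidAlgebra ℂ (FreeMonoid (X ⊕ X))))

instance : Algebra ℂ (FreeStarAlgebra X) :=
  inferInstanceAs (Algebra ℂ (MonoidAlgebra ℂ (FreeMonoid (X ⊕ X))))

/-- The word `w` as an element of the free `*`-algebra. -/
def word : FreeMonoid (X ⊕ X) →* FreeStarAlgebra X := MonoidAlgebra.of ℂ (FreeMonoid (X ⊕ X))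

/-- The generator `x`. -/
def gen (x : X) : FreeStarAlgebra X := word (FreeMonoid.of (Sum.inl x))

/-- Conjugation of scalars, with values in the opposite algebra. -/
def conjOp (X : Type) : ℂ →+* (MonoidAlgebra ℂ (FreeMonoid (X ⊕ X)))ᵐᵒᵖ :=
  (algebraMap ℂ (MonoidAlgebra ℂ (FreeMonoid (X ⊕ X)))ᵐᵒᵖ).comp (starRingEnd ℂ)

/-- The anti-multiplicative map on words exchanging the letters `x` and `x*`. -/
def swapOp (X : Type) : FreeMonoid (X ⊕ X) →* (MonoidAlgebra ℂ (FreeMonoid (X ⊕ X)))ᵐᵒᵖ :=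
  FreeMonoid.lift fun y : X ⊕ X =>
    MulOpposite.op (MonoidAlgebra.of ℂ (FreeMonoid (X ⊕ X)) (FreeMonoid.of y.swap))

lemma commute_conjOp_swapOp (X : Type) (c : ℂ) (w : FreeMonoid (X ⊕ X)) :
    Commute (conjOp X c) (swapOp X w) :=
  Algebra.commutes (A := (MonoidAlgebra ℂ (FreeMonoid (X ⊕ X)))ᵐᵒᵖ) (starRingEnd ℂ c) (swapOp X w)

/-- The conjugate-linear anti-automorphism exchanging `x` and `x*`, as a ring homomorphism into
the opposite algebra. -/
def starHom : FreeStarAlgebra X →+* (FreeStarAlgebra X)ᵐᵒᵖ :=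
  MonoidAlgebra.liftNCRingHom (conjOp X) (swapOp X) (commute_conjOp_swapOp X)

lemma starHom_algebraMap (c : ℂ) :
    starHom (algebraMap ℂ (FreeStarAlgebra X) c)
      = MulOpposite.op (algebraMap ℂ (FreeStarAlgebra X) (starRingEnd ℂ c)) := by
  refine (MonoidAlgebra.liftNCRingHom_single (conjOp X) (swapOp X) (commute_conjOp_swapOp X)
    1 c).trans ?_
  rw [map_one, mul_one]
  rfl

lemma starHom_word_of (y : X ⊕ X) :
    starHom (word (FreeMonoid.of y)) = MulOpposite.op (word (FreeMonoid.of y.swap)) := by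
  refine (MonoidAlgebra.liftNCRingHom_single (conjOp X) (swapOp X) (commute_conjOp_swapOp X)
    (FreeMonoid.of y) 1).trans ?_
  rw [map_one, one_mul, swapOp, FreeMonoid.lift_eval_of]
  rfl

/-- Induction principle: the free `*`-algebra is generated by scalars and letters. -/
lemma induction {p : FreeStarAlgebra X → Prop} (hc : ∀ c : ℂ, p (algebraMap ℂ _ c))
    (hl : ∀ y : X ⊕ X, p (word (FreeMonoid.of y))) (hadd : ∀ a b, p a → p b → p (a + b))
    (hmul : ∀ a b, p a → p b → p (a * b)) (a : FreeStarAlgebra X) : p a := by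
  have hw : ∀ w : FreeMonoid (X ⊕ X), p (word w) := by
    intro w
    induction w using FreeMonoid.inductionOn with
    | one =>
      rw [map_one, ← map_one (algebraMap ℂ (FreeStarAlgebra X))]
      exact hc 1
    | of y => exact hl y
    | mul x y hx hy => rw [map_mul]; exact hmul _ _ hx hy
  refine MonoidAlgebra.induction_on (motive := p) a hw (fun f g => hadd f g) ?_
  intro c f hf
  change p (c • (show FreeStarAlgebra X from f))
  rw [Algebra.smul_def]
  exact hmul _ _ (hc c) hf

instance : StarRing (FreeStarAlgebra X) where
  star a := (starHom a).unop
  star_involutive a := by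
    induction a using FreeStarAlgebra.induction with
    | hc c => simp [starHom_algebraMap]
    | hl y => simp [starHom_word_of]
    | hadd a b ha hb => simp [ha, hb]
    | hmul a b ha hb => simp [ha, hb]
  star_mul a b := by simp
  star_add a b := by simp

lemma star_def (a : FreeStarAlgebra X) : star a = (starHom a).unop := rfl

instance : StarModule ℂ (FreeStarAlgebra X) where
  star_smul c a := by
    rw [Algebra.smul_def, star_mul, star_def (algebraMap ℂ _ c), starHom_algebraMap,
      Algebra.smul_def, MulOpposite.unop_op, Algebra.commutes]
    rfl

lemma star_gen (x : X) : star (gen x) = word (FreeMonoid.of (Sum.inr x)) := by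
  rw [star_def, gen, starHom_word_of]; rfl

end FreeStarAlgebra

/-! ## Universal `C*`-algebras given by generators and relations -/

/-- Generators `X` and relations `r = 0` (`r` ranging over a set of `*`-polynomials in the
generators) which are admissible: in every representation of the relations by elements of a unital
`C*`-algebra, the norm of each generator is bounded by a constant depending only on the
generator. -/
structure CStarPresentation (X : Type) where
  /-- the `*`-polynomials that are to vanish -/
  rels : Set (FreeStarAlgebra X)
  /-- the relations bound the norms of the generators -/
  admissible : ∀ x : X, ∃ C : ℝ, ∀ (B : Type) [CStarAlgebra B] (φ : FreeStarAlgebra X →⋆ₐ[ℂ] B),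
    (∀ r ∈ rels, φ r = 0) → ‖φ (FreeStarAlgebra.gen x)‖ ≤ C

namespace CStarPresentation

variable {X : Type} (P : CStarPresentation X)

/-- A representation of the presentation in a unital `C*`-algebra. (As `X : Type`, the `C*`-algebra
generated by the image of any representation, in whatever universe, has a copy in `Type`, so
nothing is lost by considering only `C*`-algebras in `Type`.) -/
structure Rep where
  /-- the target -/
  B : Type
  /-- the target is a unital `C*`-algebra -/
  [cstar : CStarAlgebra B]
  /-- the homomorphism -/
  hom : FreeStarAlgebra X →⋆ₐ[ℂ] B
  /-- the relations are satisfied -/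
  map_rel : ∀ r ∈ P.rels, hom r = 0

attribute [instance] Rep.cstar

lemma bddAbove (a : FreeStarAlgebra X) : BddAbove (Set.range fun ρ : P.Rep => ‖ρ.hom a‖) := by
  suffices h : ∃ C : ℝ, ∀ ρ : P.Rep, ‖ρ.hom a‖ ≤ C by
    obtain ⟨C, hC⟩ := h
    exact ⟨C, by rintro _ ⟨ρ, rfl⟩; exact hC ρ⟩
  induction a using FreeStarAlgebra.induction with
  | hc c =>
    refine ⟨‖c‖, fun ρ => ?_⟩
    have h1 : ‖(1 : ρ.B)‖ ≤ 1 := by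
      have h := CStarRing.norm_star_mul_self (x := (1 : ρ.B))
      simp only [star_one, mul_one] at h
      nlinarith [norm_nonneg (1 : ρ.B)]
    rw [AlgHomClass.commutes, Algebra.algebraMap_eq_smul_one, norm_smul]
    exact mul_le_of_le_one_right (norm_nonneg _) h1
  | hl y =>
    rcases y with x | x
    · obtain ⟨C, hC⟩ := P.admissible x
      exact ⟨C, fun ρ => hC ρ.B ρ.hom ρ.map_rel⟩
    · obtain ⟨C, hC⟩ := P.admissible x
      refine ⟨C, fun ρ => ?_⟩
      rw [← FreeStarAlgebra.star_gen, map_star, norm_star]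
      exact hC ρ.B ρ.hom ρ.map_rel
  | hadd a b ha hb =>
    obtain ⟨C, hC⟩ := ha
    obtain ⟨D, hD⟩ := hb
    refine ⟨C + D, fun ρ => ?_⟩
    rw [map_add]
    exact (norm_add_le _ _).trans (add_le_add (hC ρ) (hD ρ))
  | hmul a b ha hb =>
    obtain ⟨C, hC⟩ := ha
    obtain ⟨D, hD⟩ := hb
    refine ⟨C * D, fun ρ => ?_⟩
    rw [map_mul]
    exact (norm_mul_le _ _).trans
      (mul_le_mul (hC ρ) (hD ρ) (norm_nonneg _) ((norm_nonneg _).trans (hC ρ)))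

/-- The universal `C*`-seminorm `a ↦ sup {‖ρ(a)‖ : ρ a representation}`. -/
def unorm (a : FreeStarAlgebra X) : ℝ := ⨆ ρ : P.Rep, ‖ρ.hom a‖

lemma le_unorm (ρ : P.Rep) (a : FreeStarAlgebra X) : ‖ρ.hom a‖ ≤ P.unorm a :=
  le_ciSup (P.bddAbove a) ρ

lemma unorm_nonneg (a : FreeStarAlgebra X) : 0 ≤ P.unorm a :=
  Real.iSup_nonneg fun _ => norm_nonneg _

lemma unorm_add (a b : FreeStarAlgebra X) : P.unorm (a + b) ≤ P.unorm a + P.unorm b := by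
  refine Real.iSup_le (fun ρ => ?_) (add_nonneg (P.unorm_nonneg a) (P.unorm_nonneg b))
  rw [map_add]
  exact (norm_add_le _ _).trans (add_le_add (P.le_unorm ρ a) (P.le_unorm ρ b))

lemma unorm_mul (a b : FreeStarAlgebra X) : P.unorm (a * b) ≤ P.unorm a * P.unorm b := by
  refine Real.iSup_le (fun ρ => ?_) (mul_nonneg (P.unorm_nonneg a) (P.unorm_nonneg b))
  rw [map_mul]
  exact (norm_mul_le _ _).trans
    (mul_le_mul (P.le_unorm ρ a) (P.le_unorm ρ b) (norm_nonneg _) (P.unorm_nonneg a))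

lemma unorm_smul_le (c : ℂ) (a : FreeStarAlgebra X) : P.unorm (c • a) ≤ ‖c‖ * P.unorm a := by
  refine Real.iSup_le (fun ρ => ?_) (mul_nonneg (norm_nonneg c) (P.unorm_nonneg a))
  rw [map_smul, norm_smul]
  exact mul_le_mul_of_nonneg_left (P.le_unorm ρ a) (norm_nonneg c)

lemma unorm_star (a : FreeStarAlgebra X) : P.unorm (star a) = P.unorm a := by
  simp only [unorm, map_star, norm_star]

lemma unorm_mul_self_le (a : FreeStarAlgebra X) :
    P.unorm a * P.unorm a ≤ P.unorm (star a * a) := by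
  have h : P.unorm a ≤ √(P.unorm (star a * a)) := by
    refine Real.iSup_le (fun ρ => ?_) (Real.sqrt_nonneg _)
    refine Real.le_sqrt_of_sq_le ?_
    rw [pow_two, ← CStarRing.norm_star_mul_self, ← map_star, ← map_mul]
    exact P.le_unorm ρ _
  calc P.unorm a * P.unorm a ≤ √(P.unorm (star a * a)) * √(P.unorm (star a * a)) :=
        mul_self_le_mul_self (P.unorm_nonneg a) h
    _ = _ := Real.mul_self_sqrt (P.unorm_nonneg _)

/-- The free `*`-algebra, to be equipped with the universal `C*`-seminorm of the presentation. -/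
@[nolint unusedArguments]
def Pre (_P : CStarPresentation X) : Type := FreeStarAlgebra X

instance : Ring P.Pre := inferInstanceAs (Ring (FreeStarAlgebra X))
instance : Algebra ℂ P.Pre := inferInstanceAs (Algebra ℂ (FreeStarAlgebra X))
instance : StarRing P.Pre := inferInstanceAs (StarRing (FreeStarAlgebra X))
instance : StarModule ℂ P.Pre := inferInstanceAs (StarModule ℂ (FreeStarAlgebra X))

/-- The universal `C*`-seminorm as a ring seminorm. -/
def ringSeminorm : RingSeminorm P.Pre where
  toFun := P.unorm
  map_zero' := by
    have h := P.unorm_smul_le 0 0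
    rw [norm_zero, zero_mul, smul_zero] at h
    exact le_antisymm h (P.unorm_nonneg 0)
  add_le' := P.unorm_add
  neg' a := by
    change P.unorm (-a) = P.unorm a
    refine iSup_congr fun ρ => ?_
    exact (congrArg norm (map_neg ρ.hom a)).trans (norm_neg _)
  mul_le' := P.unorm_mul

instance : SeminormedRing P.Pre := P.ringSeminorm.toSeminormedRing

lemma norm_def (a : P.Pre) : ‖a‖ = P.unorm a := rfl

instance : NormedAlgebra ℂ P.Pre where
  norm_smul_le := P.unorm_smul_le

/-- The universal unital `C*`-algebra of the presentation: the (separated) completion of the free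
`*`-algebra for the universal `C*`-seminorm. -/
def Univ : Type := Completion P.Pre

namespace Univ

instance : NormedRing P.Univ := inferInstanceAs (NormedRing (Completion P.Pre))
instance : CompleteSpace P.Univ := inferInstanceAs (CompleteSpace (Completion P.Pre))

/-- The canonical map from the free `*`-algebra to the universal `C*`-algebra. -/
def mk : P.Pre → P.Univ := ((↑) : P.Pre → Completion P.Pre)

variable {P}

lemma continuous_mk : Continuous (mk P) := Completion.continuous_coe P.Pre
lemma denseRange_mk : DenseRange (mk P) := Completion.denseRange_coe
lemma norm_mk (a : P.Pre) : ‖mk P a‖ = ‖a‖ := Completion.norm_coe a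
lemma mk_add (a b : P.Pre) : mk P (a + b) = mk P a + mk P b := Completion.coe_add a b
lemma mk_mul (a b : P.Pre) : mk P (a * b) = mk P a * mk P b := Completion.coe_mul a b
lemma mk_one : mk P 1 = 1 := rfl

lemma induction_on {p : P.Univ → Prop} (a : P.Univ) (hp : IsClosed {a | p a})
    (h : ∀ a : P.Pre, p (mk P a)) : p a := Completion.induction_on a hp h

instance : Algebra ℂ P.Univ := inferInstanceAs (Algebra ℂ (Completion P.Pre))

lemma mk_smul (c : ℂ) (a : P.Pre) : mk P (c • a) = c • mk P a := Completion.coe_smul c a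

instance : NormedAlgebra ℂ P.Univ where
  norm_smul_le c x := norm_smul_le c (show Completion P.Pre from x)

lemma norm_star_pre (a : P.Pre) : ‖star a‖ = ‖a‖ := P.unorm_star a

lemma isometry_star_pre : Isometry (star : P.Pre → P.Pre) :=
  AddMonoidHomClass.isometry_of_norm (starAddEquiv : P.Pre ≃+ P.Pre) norm_star_pre

instance : Star P.Univ := ⟨Completion.map (star : P.Pre → P.Pre)⟩

lemma continuous_star' : Continuous (star : P.Univ → P.Univ) := Completion.continuous_map

lemma mk_star (a : P.Pre) : mk P (star a) = star (mk P a) :=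
  (Completion.map_coe isometry_star_pre.uniformContinuous a).symm

instance : StarRing P.Univ where
  star_involutive a := by
    induction a using Univ.induction_on with
    | hp => exact isClosed_eq (continuous_star'.comp continuous_star') continuous_id
    | h a => rw [← mk_star, ← mk_star, star_star]
  star_mul a b := by
    induction a using Univ.induction_on with
    | hp =>
      exact isClosed_eq (continuous_star'.comp (continuous_id.mul continuous_const))
        (continuous_const.mul continuous_star')
    | h a =>
      induction b using Univ.induction_on with
      | hp =>
        exact isClosed_eq (continuous_star'.comp (continuous_const.mul continuous_id))
          (continuous_star'.mul continuous_const)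
      | h b => rw [← mk_mul, ← mk_star, ← mk_star, ← mk_star, ← mk_mul, star_mul]
  star_add a b := by
    induction a using Univ.induction_on with
    | hp =>
      exact isClosed_eq (continuous_star'.comp (continuous_id.add continuous_const))
        (continuous_star'.add continuous_const)
    | h a =>
      induction b using Univ.induction_on with
      | hp =>
        exact isClosed_eq (continuous_star'.comp (continuous_const.add continuous_id))
          (continuous_const.add continuous_star')
      | h b => rw [← mk_add, ← mk_star, ← mk_star, ← mk_star, ← mk_add, star_add]

instance : StarModule ℂ P.Univ where
  star_smul c a := by
    induction a using Univ.induction_on with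
    | hp =>
      exact isClosed_eq (continuous_star'.comp (continuous_const_smul c))
        (continuous_star'.const_smul (star c))
    | h a => rw [← mk_smul, ← mk_star, ← mk_star, ← mk_smul, star_smul]

instance : CStarRing P.Univ where
  norm_mul_self_le a := by
    induction a using Univ.induction_on with
    | hp =>
      exact isClosed_le (continuous_norm.mul continuous_norm)
        (continuous_norm.comp (continuous_star'.mul continuous_id))
    | h a =>
      rw [← mk_star, ← mk_mul, norm_mk, norm_mk]
      exact P.unorm_mul_self_le a

instance : CStarAlgebra P.Univ where

/-- The usual order of a `C*`-algebra, `a ≤ b` iff `b - a` is positive. -/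
instance : PartialOrder P.Univ := CStarAlgebra.spectralOrder P.Univ

instance : StarOrderedRing P.Univ := CStarAlgebra.spectralOrderedRing P.Univ

/-- The canonical map as a `*`-homomorphism. -/
def mkHom : FreeStarAlgebra X →⋆ₐ[ℂ] P.Univ where
  toFun := mk P
  map_one' := mk_one
  map_mul' := mk_mul
  map_zero' := Completion.coe_zero
  map_add' := mk_add
  commutes' _ := rfl
  map_star' := mk_star

variable (P) in
/-- The canonical generators of the universal `C*`-algebra. -/
def gen (x : X) : P.Univ := mk P (FreeStarAlgebra.gen x)

end Univ

end CStarPresentation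

/-! ## Noncommutative tori -/

/-- In a representation, an isometry has norm at most one. -/
lemma norm_le_one_of_star_mul_self {B : Type} [CStarAlgebra B] {u : B} (h : star u * u = 1) :
    ‖u‖ ≤ 1 := by
  have h1 : ‖(1 : B)‖ ≤ 1 := by
    have h := CStarRing.norm_star_mul_self (x := (1 : B))
    simp only [star_one, mul_one] at h
    nlinarith [norm_nonneg (1 : B)]
  have h2 := CStarRing.norm_star_mul_self (x := u)
  rw [h] at h2
  nlinarith [norm_nonneg u]

/-- The presentation of the noncommutative torus of a (skew-symmetric) real matrix `Θ`: the
generators `u j` are unitaries and `u j * u k = exp(2πiΘ j k) • u k * u j`. -/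
def ncTorusPresentation {n : ℕ} (Θ : Matrix (Fin n) (Fin n) ℝ) : CStarPresentation (Fin n) where
  rels :=
    {r | ∃ j, r = star (FreeStarAlgebra.gen j) * FreeStarAlgebra.gen j - 1} ∪
    {r | ∃ j, r = FreeStarAlgebra.gen j * star (FreeStarAlgebra.gen j) - 1} ∪
    {r | ∃ j k, r = FreeStarAlgebra.gen j * FreeStarAlgebra.gen k
      - Complex.exp (2 * Real.pi * Complex.I * Θ j k) •
        (FreeStarAlgebra.gen k * FreeStarAlgebra.gen j)}
  admissible j := by
    refine ⟨1, fun B _ φ hφ => norm_le_one_of_star_mul_self ?_⟩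
    have h := hφ _ (Or.inl (Or.inl ⟨j, rfl⟩))
    rwa [map_sub, map_mul, map_star, map_one, sub_eq_zero] at h

/-- The noncommutative torus of a skew-symmetric real `n × n` matrix `Θ`: the universal
`C*`-algebra generated by unitaries `u_1, …, u_n` with `u_j u_k = exp(2πiΘ_{jk}) u_k u_j`. -/
abbrev NCTorus {n : ℕ} (Θ : Matrix (Fin n) (Fin n) ℝ) : Type := (ncTorusPresentation Θ).Univ

/-- The rotation algebra `A_θ`: the universal `C*`-algebra generated by two unitaries `U`, `V`
with `U V = exp(2πiθ) V U`. -/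
abbrev RotationAlgebra (θ : ℝ) : Type := NCTorus !![0, θ; -θ, 0]

namespace RotationAlgebra

/-- The generator `U` of `A_θ`. -/
def U (θ : ℝ) : RotationAlgebra θ := CStarPresentation.Univ.gen (ncTorusPresentation _) 0

/-- The generator `V` of `A_θ`. -/
def V (θ : ℝ) : RotationAlgebra θ := CStarPresentation.Univ.gen (ncTorusPresentation _) 1

end RotationAlgebra

/-! ## Crossed products -/

section CrossedProduct

variable {A : Type} [CStarAlgebra A] {G : Type} [Group G]

/-- The copy of `a ∈ A` among the generators of the crossed product. -/
def coeffGen (a : A) : FreeStarAlgebra (A ⊕ G) := FreeStarAlgebra.gen (Sum.inl a)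

/-- The unitary of `g ∈ G` among the generators of the crossed product. -/
def unitaryGen (g : G) : FreeStarAlgebra (A ⊕ G) := FreeStarAlgebra.gen (Sum.inr g)

/-- The relations of a covariant representation of `(A, G, α)`. -/
inductive CovarianceRel (α : G →* (A ≃⋆ₐ[ℂ] A)) : FreeStarAlgebra (A ⊕ G) → Prop
  /-- `A` is represented by a unital `*`-homomorphism -/
  | one : CovarianceRel α (coeffGen 1 - 1)
  | add (a b : A) : CovarianceRel α (coeffGen (a + b) - (coeffGen a + coeffGen b))
  | smul (c : ℂ) (a : A) : CovarianceRel α (coeffGen (c • a) - c • coeffGen a)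
  | mul (a b : A) : CovarianceRel α (coeffGen (a * b) - coeffGen a * coeffGen b)
  | star (a : A) : CovarianceRel α (coeffGen (star a) - star (coeffGen a))
  /-- `G` is represented by unitaries -/
  | unitary_left (g : G) : CovarianceRel α (star (unitaryGen g) * unitaryGen g - 1)
  | unitary_right (g : G) : CovarianceRel α (unitaryGen g * star (unitaryGen g) - 1)
  | group_mul (g h : G) : CovarianceRel α (unitaryGen (g * h) - unitaryGen g * unitaryGen h)
  /-- covariance: `u_g a u_g* = α_g(a)` -/
  | covariant (g : G) (a : A) :
      CovarianceRel α (unitaryGen g * coeffGen a * star (unitaryGen g) - coeffGen (α g a))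

/-- In a covariant representation, the coefficient algebra is represented by a
`*`-homomorphism. -/
def coeffHom {α : G →* (A ≃⋆ₐ[ℂ] A)} {B : Type} [CStarAlgebra B]
    (φ : FreeStarAlgebra (A ⊕ G) →⋆ₐ[ℂ] B) (hφ : ∀ r ∈ {r | CovarianceRel α r}, φ r = 0) :
    A →⋆ₙₐ[ℂ] B where
  toFun a := φ (coeffGen a)
  map_smul' c a := by
    have h := hφ _ (CovarianceRel.smul c a)
    rwa [map_sub, map_smul, sub_eq_zero] at h
  map_zero' := by
    have h := hφ _ (CovarianceRel.smul 0 0)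
    rwa [map_sub, map_smul, zero_smul, zero_smul, sub_zero] at h
  map_add' a b := by
    have h := hφ _ (CovarianceRel.add a b)
    rwa [map_sub, map_add, sub_eq_zero] at h
  map_mul' a b := by
    have h := hφ _ (CovarianceRel.mul a b)
    rwa [map_sub, map_mul, sub_eq_zero] at h
  map_star' a := by
    have h := hφ _ (CovarianceRel.star a)
    rwa [map_sub, map_star, sub_eq_zero] at h

/-- The presentation of the (full) crossed product by a discrete group. -/
def crossedProductPresentation (α : G →* (A ≃⋆ₐ[ℂ] A)) : CStarPresentation (A ⊕ G) where
  rels := {r | CovarianceRel α r}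
  admissible x := by
    rcases x with a | g
    · exact ⟨‖a‖, fun B _ φ hφ => NonUnitalStarAlgHom.norm_apply_le (coeffHom φ hφ) a⟩
    · refine ⟨1, fun B _ φ hφ => norm_le_one_of_star_mul_self ?_⟩
      have h := hφ _ (CovarianceRel.unitary_left g)
      rwa [map_sub, map_mul, map_star, map_one, sub_eq_zero] at h

/-- The (full) crossed product `A ⋊_α G` of a unital `C*`-algebra by an action of a discrete
group: the universal `C*`-algebra for covariant representations of `(A, G, α)`. -/
abbrev CrossedProduct (α : G →* (A ≃⋆ₐ[ℂ] A)) : Type := (crossedProductPresentation α).Univ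

end CrossedProduct

/-- The rotation `(z₁, z₂) ↦ (λ^{-k₁} z₁, λ^{-k₂} z₂)` of the torus, `λ = exp(2πiθ)`. -/
def torusRotation (θ : ℝ) (k : ℤ × ℤ) : C(Circle × Circle, Circle × Circle) where
  toFun z := (Circle.exp (2 * Real.pi * θ) ^ (-k.1) * z.1,
    Circle.exp (2 * Real.pi * θ) ^ (-k.2) * z.2)
  continuous_toFun := by fun_prop

lemma torusRotation_zero (θ : ℝ) : torusRotation θ 0 = ContinuousMap.id _ := by
  ext z <;> simp [torusRotation]

lemma torusRotation_add (θ : ℝ) (k l : ℤ × ℤ) :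
    torusRotation θ (k + l) = (torusRotation θ l).comp (torusRotation θ k) := by
  ext z <;> simp [torusRotation, zpow_add, zpow_neg] <;> ring

/-- The double rotation action of `ℤ²` on `C(𝕋²)`:
`α(k₁,k₂)(f)(z₁,z₂) = f(λ^{-k₁} z₁, λ^{-k₂} z₂)`, `λ = exp(2πiθ)`. -/
def doubleRotation (θ : ℝ) : Multiplicative (ℤ × ℤ) →*
    (C(Circle × Circle, ℂ) ≃⋆ₐ[ℂ] C(Circle × Circle, ℂ)) where
  toFun k := StarAlgEquiv.ofStarAlgHom
    (ContinuousMap.compStarAlgHom' ℂ ℂ (torusRotation θ k.toAdd))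
    (ContinuousMap.compStarAlgHom' ℂ ℂ (torusRotation θ (-k.toAdd)))
    (by
      rw [← ContinuousMap.compStarAlgHom'_comp, ← torusRotation_add]
      simp [torusRotation_zero, ContinuousMap.compStarAlgHom'_id])
    (by
      rw [← ContinuousMap.compStarAlgHom'_comp, ← torusRotation_add]
      simp [torusRotation_zero, ContinuousMap.compStarAlgHom'_id])
  map_one' := by
    ext f z
    simp [torusRotation_zero]
  map_mul' k l := by
    ext f z
    simp [torusRotation_add]

/-! ## Standard representations on the `L²`-space of a trace -/

/-- `τ` is a faithful normalized trace. -/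
structure IsFaithfulTrace {A : Type} [CStarAlgebra A] [PartialOrder A] (τ : A →ₚ[ℂ] ℂ) : Prop where
  normalized : τ 1 = 1
  tracial : ∀ a b : A, τ (a * b) = τ (b * a)
  faithful : ∀ a : A, τ (star a * a) = 0 → a = 0

section Trace

variable {A : Type} [CStarAlgebra A] [PartialOrder A] [StarOrderedRing A] (τ : A →ₚ[ℂ] ℂ)

/-- The operator `a ↦ b a` of left multiplication by `b` on `L²(A, τ)`. -/
def leftMul (b : A) : τ.GNS →L[ℂ] τ.GNS := τ.gnsStarAlgHom b

variable {τ} in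
/-- Right multiplication by `b` on `A` with the `L²`-seminorm of a trace. -/
def rightMulPre (hτ : IsFaithfulTrace τ) (b : A) : τ.PreGNS →L[ℂ] τ.PreGNS :=
  (τ.toPreGNS.toLinearMap ∘ₗ LinearMap.mulRight ℂ b ∘ₗ τ.ofPreGNS.toLinearMap).mkContinuous ‖b‖
    fun x => by
      change ‖τ.toPreGNS (τ.ofPreGNS x * b)‖ ≤ ‖b‖ * ‖x‖
      rw [← sq_le_sq₀ (by positivity) (by positivity), mul_pow, ← RCLike.ofReal_le_ofReal (K := ℂ),
        RCLike.ofReal_mul, RCLike.ofReal_pow, RCLike.ofReal_pow, RCLike.ofReal_pow,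
        RCLike.ofReal_eq_complex_ofReal, PositiveLinearMap.preGNS_norm_sq,
        PositiveLinearMap.preGNS_norm_sq, PositiveLinearMap.ofPreGNS_toPreGNS, hτ.tracial,
        hτ.tracial (star (τ.ofPreGNS x))]
      have h : τ.ofPreGNS x * b * star (τ.ofPreGNS x * b) ≤
          ‖b‖ ^ 2 • (τ.ofPreGNS x * star (τ.ofPreGNS x)) := by
        have h1 := CStarAlgebra.star_right_conjugate_le_norm_smul (a := τ.ofPreGNS x)
          (b := b * star b) (hb := by cfc_tac)
        rw [CStarRing.norm_self_mul_star, ← sq] at h1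
        simpa [mul_assoc] using h1
      calc τ (τ.ofPreGNS x * b * star (τ.ofPreGNS x * b))
          ≤ τ (‖b‖ ^ 2 • (τ.ofPreGNS x * star (τ.ofPreGNS x))) := OrderHomClass.mono τ h
        _ = _ := by simp [← Complex.coe_smul]

variable {τ} in
/-- The operator `a ↦ a b` of right multiplication by `b` on `L²(A, τ)`, `τ` a trace. -/
def rightMul (hτ : IsFaithfulTrace τ) (b : A) : τ.GNS →L[ℂ] τ.GNS := (rightMulPre hτ b).completion

end Trace

section HilbertTensor

variable (H K : Type) [NormedAddCommGroup H] [InnerProductSpace ℂ H]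
  [NormedAddCommGroup K] [InnerProductSpace ℂ K]

/-- The Hilbert space tensor product: the completion of the algebraic tensor product for
`⟪a ⊗ b, c ⊗ d⟫ = ⟪a, c⟫ ⟪b, d⟫`. -/
def HilbertTensor : Type := Completion (H ⊗[ℂ] K)

instance : NormedAddCommGroup (HilbertTensor H K) :=
  inferInstanceAs (NormedAddCommGroup (Completion (H ⊗[ℂ] K)))

instance : InnerProductSpace ℂ (HilbertTensor H K) :=
  inferInstanceAs (InnerProductSpace ℂ (Completion (H ⊗[ℂ] K)))

instance : CompleteSpace (HilbertTensor H K) :=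
  inferInstanceAs (CompleteSpace (Completion (H ⊗[ℂ] K)))

variable {H K}

/-- The operator `S ⊗ T` on the Hilbert space tensor product. -/
def opTensor (S : H →L[ℂ] H) (T : K →L[ℂ] K) : HilbertTensor H K →L[ℂ] HilbertTensor H K :=
  (TensorProduct.mapL S T).completion

end HilbertTensor

open RotationAlgebra in
/-- The `C*`-algebra `𝓑` of operators on `H_τ ⊗ H_τ` generated by `U_l ⊗ 1`, `V_l ⊗ 1`, `1 ⊗ U_r`
and `1 ⊗ V_r`, where `U_l a = U a`, `V_l a = V a`, `U_r a = a U`, `V_r a = a V` on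
`H_τ = L²(A_θ, τ)`. -/
def bimoduleAlgebra {θ : ℝ} {τ : RotationAlgebra θ →ₚ[ℂ] ℂ} (hτ : IsFaithfulTrace τ) :
    StarSubalgebra ℂ (HilbertTensor τ.GNS τ.GNS →L[ℂ] HilbertTensor τ.GNS τ.GNS) :=
  (StarAlgebra.adjoin ℂ
    {opTensor (leftMul τ (U θ)) 1, opTensor (leftMul τ (V θ)) 1,
      opTensor 1 (rightMul hτ (U θ)), opTensor 1 (rightMul hτ (V θ))}).topologicalClosure

end

/-! Everything rests on the simplicity of the four-dimensional torus `NCTorus (doubleRotationMatrix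
θ)`. The generators of 𝓑, and suitable unitaries of the crossed product, satisfy its relations; each
therefore receives a unital `*`-homomorphism from it. Simplicity makes this map injective, hence
isometric with closed range, and the range contains the generators, so it is everything. This gives
both isomorphisms.

Simplicity is proved by harmonic analysis. The gauge action multiplying each generator by a power of
λ is implemented by inner automorphisms `Ad v`, where the `v` are generators or their inverses, and
a monomial in the generators is an eigenvector with eigenvalues λ to its exponents (`HasWeight`). As
λ is not a root of unity, weighted averages along the orbit λ^m realise the Fejér multipliers in the
limit; applied to functionals, they have weak-* cluster points by Banach–Alaoglu
(`exists_fejer_functional`). Order 1 yields a unital functional of norm at most 1 that kills all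
nonzero weights (`exists_invariant_functional`); letting the order grow shows that an element with
vanishing Fourier coefficients is zero (`eq_zero_of_fourierCoeff_eq_zero`). The automorphisms being
inner, a homomorphism π carries them to its target. The invariant functional can thus be built on
the target and pulled back, and if π(a) = 0 then all Fourier coefficients of a vanish
(`injective_of_hasWeight`).

The same tools give the trace of A_θ. The invariant functional is positive, tracial by its
invariance, and faithful by Cauchy–Schwarz and the vanishing of Fourier coefficients. Any trace is
invariant under inner automorphisms and so kills nonzero weights, which forces uniqueness.

Universal algebras could a priori be zero. An explicit covariant representation on ℓ²(ℤ²) excludes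
this for the crossed product and, through it, for A_θ. -/

noncomputable section

/-! ## Fejér averages over the orbit of an irrational rotation -/

section Fejer

open Filter Topology

/-- The `i`-th Fourier coefficient of the Fejér kernel of order `N`. -/
def fejerCoeff (N : ℕ) (i : ℤ) : ℝ :=
  ((Finset.range N ×ˢ Finset.range N).filter fun p : ℕ × ℕ => (p.1 : ℤ) - p.2 + i = 0).card / N

/-- The kernel of order 1 is constant, so its multiplier is the projection onto weight zero. -/
lemma fejerCoeff_one (i : ℤ) : fejerCoeff 1 i = if i = 0 then 1 else 0 := by
  simp only [fejerCoeff, Finset.range_one, Finset.singleton_product_singleton,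
    Finset.filter_singleton]
  split_ifs <;> simp_all

lemma fejerCoeff_eq_zero {N : ℕ} {i : ℤ} (h : (N : ℤ) ≤ |i|) : fejerCoeff N i = 0 := by
  rw [fejerCoeff, Finset.filter_false_of_mem, Finset.card_empty, Nat.cast_zero, zero_div]
  intro p hp
  simp only [Finset.mem_product, Finset.mem_range] at hp
  rw [le_abs] at h
  omega

lemma fejerCoeff_zero {N : ℕ} (hN : N ≠ 0) : fejerCoeff N 0 = 1 := by
  rw [fejerCoeff, show (Finset.range N ×ˢ Finset.range N).filter
    (fun p : ℕ × ℕ => (p.1 : ℤ) - p.2 + 0 = 0) = (Finset.range N).diag from ?_,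
    Finset.diag_card, Finset.card_range, div_self (by exact_mod_cast hN)]
  ext p
  simp only [Finset.mem_filter, Finset.mem_product, Finset.mem_range, Finset.mem_diag]
  omega

lemma fejerCoeff_le_one (N : ℕ) (i : ℤ) : fejerCoeff N i ≤ 1 := by
  refine div_le_one_of_le₀ ?_ (Nat.cast_nonneg _)
  refine (Nat.cast_le.2 (Finset.card_le_card_of_injOn (t := Finset.range N) Prod.fst ?_ ?_)).trans
    (by simp)
  · intro p hp
    simp only [Finset.coe_filter, Finset.mem_product, Finset.mem_range, Set.mem_ofPred_eq] at hp
    simpa using hp.1.1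
  · rintro ⟨a, b⟩ hp ⟨c, d⟩ hq h
    simp only [Finset.coe_filter, Finset.mem_product, Finset.mem_range, Set.mem_ofPred_eq] at *
    ext <;> simp <;> omega

lemma one_sub_le_fejerCoeff {N : ℕ} (hN : N ≠ 0) (i : ℤ) : 1 - |(i : ℝ)| / N ≤ fejerCoeff N i := by
  have hN' : (0 : ℝ) < N := by positivity
  rw [fejerCoeff, le_div_iff₀ hN', sub_mul, div_mul_cancel₀ _ hN'.ne', one_mul,
    sub_le_iff_le_add]
  -- The pairs (a + i⁻, a + i⁺) with a < N - |i| all solve the equation; this is the lower half of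
  -- the count N - |i|.
  have key : N - i.natAbs ≤ ((Finset.range N ×ˢ Finset.range N).filter
      fun p : ℕ × ℕ => (p.1 : ℤ) - p.2 + i = 0).card := by
    have := Finset.card_le_card_of_injOn (s := Finset.range (N - i.natAbs))
      (t := (Finset.range N ×ˢ Finset.range N).filter
        fun p : ℕ × ℕ => (p.1 : ℤ) - p.2 + i = 0)
      (fun a => (a + (-i).toNat, a + i.toNat)) ?_ ?_
    · simpa using this
    · intro a ha
      simp only [Finset.coe_range, Set.mem_Iio, Finset.coe_filter, Finset.mem_product,
        Finset.mem_range, Set.mem_ofPred_eq] at *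
      omega
    · intro a _ b _ h
      simpa using congrArg Prod.fst h
  have h2 : N ≤ ((Finset.range N ×ˢ Finset.range N).filter
      fun p : ℕ × ℕ => (p.1 : ℤ) - p.2 + i = 0).card + i.natAbs := by omega
  have h3 : |(i : ℝ)| = (i.natAbs : ℝ) := by
    rw [← Int.cast_abs, Int.abs_eq_natAbs]; simp
  rw [h3]
  exact_mod_cast h2

lemma tendsto_fejerCoeff (i : ℤ) : Tendsto (fun N => fejerCoeff (N + 1) i) atTop (𝓝 1) := by
  refine tendsto_of_tendsto_of_tendsto_of_le_of_le (g := fun N : ℕ => 1 - |(i : ℝ)| / ((N + 1 : ℕ) : ℝ))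
    ?_ tendsto_const_nhds (fun N => one_sub_le_fejerCoeff N.succ_ne_zero i)
    (fun N => fejerCoeff_le_one _ i)
  have h := (tendsto_const_div_atTop_nhds_zero_nat |(i : ℝ)|).comp (tendsto_add_atTop_nat 1)
  simpa using h.const_sub 1

/-- The geometric sums stay bounded by 2 / ‖z - 1‖, so dividing by M sends them to zero. -/
lemma tendsto_mean_pow {z : ℂ} (hz : ‖z‖ = 1) (h1 : z ≠ 1) :
    Tendsto (fun M : ℕ => (M : ℂ)⁻¹ * ∑ m ∈ Finset.range M, z ^ m) atTop (𝓝 0) := by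
  have h1' : z - 1 ≠ 0 := sub_ne_zero.2 h1
  refine squeeze_zero_norm (a := fun M : ℕ => (2 / ‖z - 1‖) / M) (fun M => ?_)
    (tendsto_const_div_atTop_nhds_zero_nat _)
  rw [geom_sum_eq h1, norm_mul, norm_inv, Complex.norm_natCast, norm_div, inv_mul_eq_div]
  gcongr
  refine (norm_sub_le _ _).trans ?_
  rw [norm_pow, hz]; norm_num

/-- The Fejér kernel of order `N`. -/
def fejerKernel (N : ℕ) (z : ℂ) : ℝ := ‖∑ i ∈ Finset.range N, z ^ i‖ ^ 2 / N

lemma fejerKernel_nonneg (N : ℕ) (z : ℂ) : 0 ≤ fejerKernel N z := by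
  unfold fejerKernel; positivity

lemma fejerKernel_coe (N : ℕ) (z : Circle) :
    (fejerKernel N z : ℂ) = (N : ℂ)⁻¹ * ∑ p ∈ Finset.range N ×ˢ Finset.range N,
      ((z ^ ((p.1 : ℤ) - p.2) : Circle) : ℂ) := by
  rw [fejerKernel, Complex.ofReal_div, Complex.ofReal_pow, ← Complex.mul_conj', Finset.sum_product,
    map_sum, Finset.sum_mul_sum, Complex.ofReal_natCast, div_eq_inv_mul]
  congr 1
  refine Finset.sum_congr rfl fun i _ => Finset.sum_congr rfl fun j _ => ?_
  rw [zpow_sub, Circle.coe_mul, zpow_natCast, zpow_natCast, Circle.coe_inv_eq_conj]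
  simp

variable {lam : Circle}

/-- The orbit of an element of infinite order is equidistributed: orbit averages of a character tend
to its integral, and the kernel is a finite combination of characters. -/
lemma tendsto_mean_fejerKernel (hlam : ∀ i : ℤ, lam ^ i = 1 → i = 0) (N : ℕ) (i : ℤ) :
    Tendsto (fun M : ℕ => (M : ℂ)⁻¹ * ∑ m ∈ Finset.range M,
      (fejerKernel N (lam ^ m : Circle) : ℂ) * ((lam ^ i : Circle) : ℂ) ^ m) atTop
      (𝓝 (fejerCoeff N i : ℂ)) := by
  have h : ∀ M : ℕ, (M : ℂ)⁻¹ * ∑ m ∈ Finset.range M,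
      (fejerKernel N (lam ^ m : Circle) : ℂ) * ((lam ^ i : Circle) : ℂ) ^ m =
      (N : ℂ)⁻¹ * ∑ p ∈ Finset.range N ×ˢ Finset.range N, (M : ℂ)⁻¹ * ∑ m ∈ Finset.range M,
        ((lam ^ ((p.1 : ℤ) - p.2 + i) : Circle) : ℂ) ^ m := by
    intro M
    simp_rw [fejerKernel_coe, Finset.mul_sum, Finset.sum_mul, Finset.mul_sum]
    rw [Finset.sum_comm]
    refine Finset.sum_congr rfl fun p _ => Finset.sum_congr rfl fun m _ => ?_
    rw [zpow_add, Circle.coe_mul, mul_pow, ← zpow_natCast lam m, zpow_comm, zpow_natCast,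
      Circle.coe_pow]
    ring
  simp_rw [h]
  rw [show (fejerCoeff N i : ℂ) = (N : ℂ)⁻¹ * ∑ p ∈ Finset.range N ×ˢ Finset.range N,
      (if (p.1 : ℤ) - p.2 + i = 0 then 1 else 0) by
    rw [fejerCoeff, Finset.sum_ite]; simp [div_eq_inv_mul]]
  refine (tendsto_finsetSum _ fun p _ => ?_).const_mul _
  split_ifs with hp
  · refine Tendsto.congr' ?_ tendsto_const_nhds
    filter_upwards [eventually_ne_atTop 0] with M hM
    have : (M : ℂ) ≠ 0 := by exact_mod_cast hM
    simp [hp, this]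
  · refine tendsto_mean_pow (Circle.norm_coe _) fun h1 => hp (hlam _ ?_)
    exact Circle.coe_eq_one.1 h1

/-- Probability weights along an orbit realising the Fejér multipliers in the limit. -/
lemma exists_fejer_weights (hlam : ∀ i : ℤ, lam ^ i = 1 → i = 0) {N : ℕ} (hN : N ≠ 0) :
    ∃ p : ℕ → ℕ → ℝ, (∀ M m, 0 ≤ p M m) ∧ (∀ M, ∑ m ∈ Finset.range M, p M m ≤ 1) ∧
      ∀ i : ℤ, Tendsto (fun M => ∑ m ∈ Finset.range M, (p M m : ℂ) * ((lam ^ i : Circle) : ℂ) ^ m)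
        atTop (𝓝 (fejerCoeff N i : ℂ)) := by
  refine ⟨fun M m => fejerKernel N (lam ^ m : Circle) /
    ∑ m ∈ Finset.range M, fejerKernel N (lam ^ m : Circle), fun M m => ?_, fun M => ?_,
    fun i => ?_⟩
  · exact div_nonneg (fejerKernel_nonneg _ _) (Finset.sum_nonneg fun _ _ => fejerKernel_nonneg _ _)
  -- The total is only bounded by 1 because the empty sum at M = 0 gives 0 / 0 = 0.
  · rw [← Finset.sum_div]; exact div_self_le_one _
  · have h0 := tendsto_mean_fejerKernel hlam N 0
    rw [fejerCoeff_zero hN] at h0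
    -- The normalising mean tends to the zeroth coefficient, which is 1, so dividing by it does not
    -- change the limit.
    have h := (tendsto_mean_fejerKernel hlam N i).div h0 (by simp)
    rw [Complex.ofReal_one, div_one] at h
    refine h.congr' ?_
    filter_upwards [eventually_ne_atTop 0] with M hM
    have hM' : (M : ℂ) ≠ 0 := by exact_mod_cast hM
    simp only [zpow_zero, Circle.coe_one, one_pow, mul_one, Pi.div_apply]
    rw [mul_div_mul_left _ _ (inv_ne_zero hM'), Finset.sum_div]
    refine Finset.sum_congr rfl fun m _ => ?_
    push_cast
    ring

end Fejer

/-! ## Spectral multipliers on functionals -/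

section Weights

open Filter Topology

variable {A : Type*} [CStarAlgebra A] {ι : Type*} (v : ι → unitary A) (lam : Circle)

/-- `x` is an eigenvector of the inner automorphisms `Ad (v j)` for the eigenvalues `lam ^ k j`. -/
def HasWeight (k : ι → ℤ) (x : A) : Prop :=
  ∀ j, (v j : A) * x * star (v j : A) = ((lam ^ k j : Circle) : ℂ) • x

variable {v lam}

lemma HasWeight.one : HasWeight v lam 0 1 := fun j => by simp

lemma HasWeight.mul {k l : ι → ℤ} {x y : A} (hx : HasWeight v lam k x) (hy : HasWeight v lam l y) :
    HasWeight v lam (k + l) (x * y) := fun j => by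
  calc (v j : A) * (x * y) * star (v j : A)
      = ((v j : A) * x * star (v j : A)) * ((v j : A) * y * star (v j : A)) := by
        simp only [mul_assoc]
        rw [← mul_assoc (star (v j : A)) (v j : A), Unitary.coe_star_mul_self, one_mul]
    _ = _ := by
      rw [hx j, hy j, smul_mul_smul_comm, Pi.add_apply, zpow_add, Circle.coe_mul]

lemma HasWeight.star {k : ι → ℤ} {x : A} (hx : HasWeight v lam k x) :
    HasWeight v lam (-k) (star x) := fun j => by
  have h := congrArg Star.star (hx j)
  rw [star_mul, star_mul, star_star, star_smul, ← mul_assoc] at h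
  rw [h, Pi.neg_apply, zpow_neg, Circle.coe_inv_eq_conj]
  rfl

/-- A Fejér multiplier in one direction. -/
lemma exists_fejer_functional (hlam : ∀ i : ℤ, lam ^ i = 1 → i = 0) {N : ℕ} (hN : N ≠ 0)
    (u : unitary A) (ψ : A →L[ℂ] ℂ) :
    ∃ ψ' : A →L[ℂ] ℂ, ‖ψ'‖ ≤ ‖ψ‖ ∧ ∀ (i : ℤ) (x : A),
      (u : A) * x * star (u : A) = ((lam ^ i : Circle) : ℂ) • x →
        ψ' x = fejerCoeff N i * ψ x := by
  obtain ⟨p, hp0, hp1, hp⟩ := exists_fejer_weights hlam hN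
  let T : ℕ → A →L[ℂ] A := fun m =>
    ContinuousLinearMap.mulLeftRight ℂ A ((u ^ m : unitary A) : A) (star ((u ^ m : unitary A) : A))
  have hT : ∀ m x, T m x = ((u ^ m : unitary A) : A) * x * star ((u ^ m : unitary A) : A) :=
    fun m x => ContinuousLinearMap.mulLeftRight_apply ..
  have hTn : ∀ m x, ‖T m x‖ ≤ ‖x‖ := fun m x => by
    rw [hT, ← Unitary.coe_star, CStarRing.norm_mul_coe_unitary, CStarRing.norm_coe_unitary_mul]
  let Ψ : ℕ → WeakDual ℂ A := fun M =>
    StrongDual.toWeakDual (∑ m ∈ Finset.range M, (p M m : ℂ) • ψ.comp (T m))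
  have hΨ : ∀ M x, Ψ M x = ∑ m ∈ Finset.range M, (p M m : ℂ) * ψ (T m x) := fun M x => by
    change (∑ m ∈ Finset.range M, (p M m : ℂ) • ψ.comp (T m)) x = _
    simp
  have hmem : ∀ M, Ψ M ∈ WeakDual.toStrongDual ⁻¹' Metric.closedBall (0 : StrongDual ℂ A) ‖ψ‖ := by
    intro M
    rw [Set.mem_preimage, mem_closedBall_zero_iff]
    refine ContinuousLinearMap.opNorm_le_bound _ (norm_nonneg _) fun x => ?_
    change ‖Ψ M x‖ ≤ _
    rw [hΨ]
    calc ‖∑ m ∈ Finset.range M, (p M m : ℂ) * ψ (T m x)‖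
        ≤ ∑ m ∈ Finset.range M, p M m * (‖ψ‖ * ‖x‖) := by
          refine norm_sum_le_of_le _ fun m _ => ?_
          rw [norm_mul, Complex.norm_real, Real.norm_of_nonneg (hp0 _ _)]
          refine mul_le_mul_of_nonneg_left ?_ (hp0 _ _)
          exact (ψ.le_opNorm _).trans (mul_le_mul_of_nonneg_left (hTn m x) (norm_nonneg _))
      _ ≤ _ := by
          rw [← Finset.sum_mul]
          exact mul_le_of_le_one_left (by positivity) (hp1 M)
  -- Banach–Alaoglu: the averaged functionals stay in a weak-* compact ball. A cluster point
  -- suffices, and no separability of `A` is required.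
  obtain ⟨ψ', hψ', hcl⟩ := (WeakDual.isCompact_closedBall (0 : StrongDual ℂ A) ‖ψ‖).exists_mapClusterPt
    (f := atTop) (u := Ψ) (by
      rw [le_principal_iff]
      exact Filter.mem_map.2 (Eventually.of_forall hmem))
  refine ⟨WeakDual.toStrongDual ψ', by simpa using hψ', fun i x hx => ?_⟩
  have hTx : ∀ m, T m x = (((lam ^ i : Circle) : ℂ) ^ m) • x := by
    intro m
    rw [hT]
    induction m with
    | zero => simp
    | succ m ih =>
      have : ((u ^ (m + 1) : unitary A) : A) = ((u : A)) * ((u ^ m : unitary A) : A) := by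
        rw [pow_succ']; rfl
      rw [this, star_mul]
      calc (u : A) * ((u ^ m : unitary A) : A) * x * (star ((u ^ m : unitary A) : A) * star (u : A))
          = (u : A) * (((u ^ m : unitary A) : A) * x * star ((u ^ m : unitary A) : A))
            * star (u : A) := by simp only [mul_assoc]
        _ = _ := by
          rw [ih, mul_smul_comm, smul_mul_assoc, hx, smul_smul, pow_succ]
  have hlim : Tendsto (fun M => Ψ M x) atTop (𝓝 (fejerCoeff N i * ψ x)) := by
    refine ((hp i).mul_const (ψ x)).congr fun M => ?_
    rw [hΨ, Finset.sum_mul]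
    refine Finset.sum_congr rfl fun m _ => ?_
    rw [hTx, map_smul, smul_eq_mul, mul_assoc]
  have hcl' : MapClusterPt (ψ' x) atTop (fun M => Ψ M x) :=
    hcl.tendsto_comp ((WeakDual.eval_continuous x).tendsto ψ')
  -- On an eigenvector the averages converge, so their cluster value must be the limit.
  have : (𝓝 (ψ' x) ⊓ 𝓝 (fejerCoeff N i * ψ x)).NeBot :=
    NeBot.mono hcl' (inf_le_inf_left _ hlim)
  exact eq_of_nhds_neBot this

end Weights

/-! ### Fourier coefficients and simplicity -/

section Multipliers

open Filter Topology

variable {A : Type*} [CStarAlgebra A] {ι : Type*} [Fintype ι] {v : ι → unitary A} {lam : Circle}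

variable (v) in
/-- The Fejér multiplier in all directions. -/
lemma exists_fejer_functional_prod (hlam : ∀ i : ℤ, lam ^ i = 1 → i = 0) {N : ℕ} (hN : N ≠ 0)
    (ψ : A →L[ℂ] ℂ) :
    ∃ ψ' : A →L[ℂ] ℂ, ‖ψ'‖ ≤ ‖ψ‖ ∧ ∀ (k : ι → ℤ) (x : A), HasWeight v lam k x →
      ψ' x = (∏ j, (fejerCoeff N (k j) : ℂ)) * ψ x := by
  suffices h : ∀ s : Finset ι, ∃ ψ' : A →L[ℂ] ℂ, ‖ψ'‖ ≤ ‖ψ‖ ∧ ∀ (k : ι → ℤ) (x : A),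
      HasWeight v lam k x → ψ' x = (∏ j ∈ s, (fejerCoeff N (k j) : ℂ)) * ψ x from h Finset.univ
  classical
  intro s
  induction s using Finset.induction_on with
  | empty => exact ⟨ψ, le_rfl, fun k x _ => by simp⟩
  | insert j s hj ih =>
    obtain ⟨ψ₁, h₁, h₁'⟩ := ih
    obtain ⟨ψ₂, h₂, h₂'⟩ := exists_fejer_functional hlam hN (v j) ψ₁
    refine ⟨ψ₂, h₂.trans h₁, fun k x hx => ?_⟩
    rw [h₂' _ x (hx j), h₁' k x hx, Finset.prod_insert hj, mul_assoc]

variable (v) in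
/-- In a nontrivial `C*`-algebra there is a functional of norm one that is unital and vanishes on
the elements of nonzero weight. -/
lemma exists_invariant_functional [Nontrivial A] (hlam : ∀ i : ℤ, lam ^ i = 1 → i = 0) :
    ∃ φ : A →L[ℂ] ℂ, ‖φ‖ ≤ 1 ∧ φ 1 = 1 ∧
      ∀ (k : ι → ℤ) (x : A), HasWeight v lam k x → k ≠ 0 → φ x = 0 := by
  obtain ⟨ψ, hψ, hψ1⟩ := exists_dual_vector' ℂ (1 : A)
  rw [CStarRing.norm_one] at hψ1
  obtain ⟨φ, hφ, hφ'⟩ := exists_fejer_functional_prod v hlam one_ne_zero ψ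
  refine ⟨φ, hφ.trans hψ.le, ?_, fun k x hx hk => ?_⟩
  · rw [hφ' 0 1 HasWeight.one, hψ1]
    simp [fejerCoeff_one]
  · obtain ⟨j, hj⟩ := Function.ne_iff.1 hk
    rw [hφ' k x hx, Finset.prod_eq_zero (Finset.mem_univ j), zero_mul]
    simpa [fejerCoeff_one] using hj

/-- An element all of whose Fourier coefficients vanish is zero. -/
lemma eq_zero_of_fourierCoeff_eq_zero (hlam : ∀ i : ℤ, lam ^ i = 1 → i = 0)
    {w : (ι → ℤ) → A} (hw : ∀ k, HasWeight v lam k (w k)) (hw1 : ∀ k, w k * star (w k) = 1)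
    (hdense : (Submodule.span ℂ (Set.range w)).topologicalClosure = ⊤)
    {φ : A →L[ℂ] ℂ} (hφ1 : φ 1 = 1)
    (hφ : ∀ (k : ι → ℤ) (x : A), HasWeight v lam k x → k ≠ 0 → φ x = 0)
    {a : A} (ha : ∀ k, φ (a * star (w k)) = 0) : a = 0 := by
  classical
  have hd : Dense (Submodule.span ℂ (Set.range w) : Set A) :=
    Submodule.dense_iff_topologicalClosure_eq_top.2 hdense
  refine (SeparatingDual.eq_zero_of_forall_dual_eq_zero (R := ℂ) fun ψ => ?_)
  choose Ψ hΨ hΨ' using fun N : ℕ => exists_fejer_functional_prod v hlam N.succ_ne_zero ψ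
  -- Orthonormality: w l * star (w k) has weight l - k.
  have hcoeff : ∀ k l, φ (w l * star (w k)) = if k = l then 1 else 0 := by
    intro k l
    split_ifs with h
    · rw [h, hw1, hφ1]
    · refine hφ _ _ ((hw l).mul (hw k).star) fun h0 => h ?_
      rw [← sub_eq_add_neg, sub_eq_zero] at h0
      exact h0.symm
  have hzero : ∀ N, Ψ N a = 0 := by
    intro N
    -- Outside this box some |k j| is at least N + 1, so the Fejér product vanishes. `Φ` is the
    -- Cesàro-truncated Fourier series of `ψ`, a finite combination of Fourier coefficient
    -- functionals; it agrees with `Ψ N` on the dense span.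
    let s : Finset (ι → ℤ) := Fintype.piFinset fun _ => Finset.Ioo (-(N + 1 : ℤ)) (N + 1)
    let Φ : A →L[ℂ] ℂ := ∑ k ∈ s, (∏ j, (fejerCoeff (N + 1) (k j) : ℂ)) • ψ (w k) •
      φ.comp ((ContinuousLinearMap.mul ℂ A).flip (star (w k)))
    have hΦ : ∀ x, Φ x = ∑ k ∈ s, (∏ j, (fejerCoeff (N + 1) (k j) : ℂ)) *
        (ψ (w k) * φ (x * star (w k))) := fun x => by simp [Φ]
    have : Ψ N = Φ := by
      refine ContinuousLinearMap.ext_on hd ?_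
      rintro _ ⟨l, rfl⟩
      rw [hΨ' N l _ (hw l), hΦ]
      simp_rw [hcoeff, mul_ite, mul_one, mul_zero, Finset.sum_ite_eq']
      split_ifs with hl
      · rfl
      · simp only [s, Fintype.mem_piFinset, not_forall, Finset.mem_Ioo] at hl
        obtain ⟨j, hj⟩ := hl
        rw [Finset.prod_eq_zero (Finset.mem_univ j), zero_mul]
        rw [fejerCoeff_eq_zero, Complex.ofReal_zero]
        rw [le_abs]; push_cast; omega
    rw [this, hΦ]
    simp [ha]
  -- Convergence is clear on the span of the `w k`, where the multipliers tend to 1; the bound ‖Ψ N‖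
  -- ≤ ‖ψ‖ extends it to the closure.
  have hlim : Tendsto (fun N => Ψ N a) atTop (𝓝 (ψ a)) := by
    rw [Metric.tendsto_atTop]
    intro ε hε
    -- Three errors of at most ε / 4 are to be added. The `+ 1` keeps the denominator positive when
    -- ψ = 0.
    obtain ⟨b, hb, hab⟩ := Metric.mem_closure_iff.1 (hd a) (ε / (4 * (‖ψ‖ + 1))) (by positivity)
    have hlimb : Tendsto (fun N => Ψ N b) atTop (𝓝 (ψ b)) := by
      refine Submodule.span_induction ?_ ?_ ?_ ?_ hb
      · rintro _ ⟨k, rfl⟩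
        simp_rw [fun N => hΨ' N k _ (hw k)]
        have h : Tendsto (fun N => ∏ j, (fejerCoeff (N + 1) (k j) : ℂ)) atTop (𝓝 (∏ j : ι, 1)) :=
          tendsto_finsetProd _ fun j _ => by
            exact_mod_cast (Complex.continuous_ofReal.tendsto 1).comp (tendsto_fejerCoeff (k j))
        simpa using h.mul_const (ψ (w k))
      · simp
      · intro x y _ _ hx hy
        simpa using hx.add hy
      · intro c x _ hx
        simpa using hx.const_mul c
    obtain ⟨N₀, hN₀⟩ := Metric.tendsto_atTop.1 hlimb (ε / 4) (by positivity)
    have hsmall : ‖ψ‖ * ‖a - b‖ ≤ ε / 4 := by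
      rw [dist_eq_norm, lt_div_iff₀ (by positivity)] at hab
      nlinarith [norm_nonneg ψ, norm_nonneg (a - b)]
    refine ⟨N₀, fun N hN => ?_⟩
    have h1 : ‖Ψ N (a - b)‖ ≤ ε / 4 :=
      ((Ψ N).le_opNorm _).trans
        ((mul_le_mul_of_nonneg_right (hΨ N) (norm_nonneg _)).trans hsmall)
    have h2 : ‖ψ (a - b)‖ ≤ ε / 4 := (ψ.le_opNorm _).trans hsmall
    have h3 := hN₀ N hN
    rw [dist_eq_norm] at h3 ⊢
    have h4 : Ψ N a - ψ a = Ψ N (a - b) + (Ψ N b - ψ b) - ψ (a - b) := by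
      rw [map_sub, map_sub]; ring
    rw [h4]
    refine (norm_sub_le _ _).trans_lt ?_
    have := norm_add_le (Ψ N (a - b)) (Ψ N b - ψ b)
    linarith
  simp_rw [hzero] at hlim
  exact (tendsto_nhds_unique tendsto_const_nhds hlim).symm

/-- Simplicity: a unital `*`-homomorphism to a nontrivial algebra is injective. -/
lemma injective_of_hasWeight {C : Type*} [CStarAlgebra C] [Nontrivial C]
    (hlam : ∀ i : ℤ, lam ^ i = 1 → i = 0)
    {w : (ι → ℤ) → A} (hw : ∀ k, HasWeight v lam k (w k)) (hw1 : ∀ k, w k * star (w k) = 1)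
    (hdense : (Submodule.span ℂ (Set.range w)).topologicalClosure = ⊤) (π : A →⋆ₐ[ℂ] C) :
    Function.Injective π := by
  -- The functional lives on the target, with respect to the images of the implementing unitaries;
  -- its pullback then vanishes on the kernel of π.
  obtain ⟨φ, -, hφ1, hφ⟩ := exists_invariant_functional
    (fun j => (⟨π (v j), Unitary.map_mem π (v j).2⟩ : unitary C)) hlam
  have hπ : Continuous π := 
    AddMonoidHomClass.continuous_of_bound π 1 fun x => by
      simpa using NonUnitalStarAlgHom.norm_apply_le π x
  rw [injective_iff_map_eq_zero]
  intro a ha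
  let π' : A →L[ℂ] C := ⟨π.toAlgHom.toLinearMap, hπ⟩
  refine eq_zero_of_fourierCoeff_eq_zero hlam hw hw1 hdense (φ := φ.comp π') ?_ ?_ ?_
  · change φ (π 1) = 1
    rw [map_one, hφ1]
  · intro k x hx hk
    refine hφ k (π x) (fun j => ?_) hk
    have := congrArg π (hx j)
    simpa [map_star] using this
  · intro k
    change φ (π (a * star (w k))) = 0
    rw [map_mul, ha, zero_mul, map_zero]

end Multipliers

/-! ## Universal properties -/

namespace FreeStarAlgebra

variable {X : Type} {B : Type*} [Ring B] [StarRing B] [Algebra ℂ B]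

/-- The underlying algebra homomorphism of `FreeStarAlgebra.lift`. -/
def liftAux (g : X → B) : FreeStarAlgebra X →ₐ[ℂ] B :=
  MonoidAlgebra.lift ℂ B (FreeMonoid (X ⊕ X))
    (FreeMonoid.lift (Sum.elim g fun x => star (g x)))

lemma liftAux_word_of (g : X → B) (y : X ⊕ X) :
    liftAux g (word (FreeMonoid.of y)) = Sum.elim g (fun x => star (g x)) y := by
  refine (MonoidAlgebra.lift_of _ _).trans ?_
  rw [FreeMonoid.lift_eval_of]

/-- The `*`-homomorphism from the free `*`-algebra determined by the images of the generators. -/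
def lift [StarModule ℂ B] (g : X → B) : FreeStarAlgebra X →⋆ₐ[ℂ] B where
  __ := liftAux g
  map_star' a := by
    change liftAux g (star a) = star (liftAux g a)
    induction a using FreeStarAlgebra.induction with
    | hc c =>
      rw [star_def, starHom_algebraMap, MulOpposite.unop_op, AlgHom.commutes, AlgHom.commutes,
        ← algebraMap_star_comm]
      rfl
    | hl y =>
      rw [star_def, starHom_word_of, MulOpposite.unop_op, liftAux_word_of, liftAux_word_of]
      rcases y with x | x <;> simp
    | hadd a b ha hb => rw [star_add, map_add, map_add, star_add, ha, hb]
    | hmul a b ha hb => rw [star_mul, map_mul, map_mul, star_mul, ha, hb]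

@[simp]
lemma lift_gen [StarModule ℂ B] (g : X → B) (x : X) : lift g (gen x) = g x := liftAux_word_of g (Sum.inl x)

end FreeStarAlgebra

namespace CStarPresentation.Univ

variable {X : Type} {P : CStarPresentation X}

/-- Every representation kills `r`, so its universal seminorm is zero, and the completion is
separated. -/
lemma mkHom_rel {r : FreeStarAlgebra X} (hr : r ∈ P.rels) : mkHom (P := P) r = 0 := by
  rw [← norm_eq_zero]
  refine (norm_mk (P := P) r).trans (le_antisymm ?_ (norm_nonneg (show P.Pre from r)))
  refine Real.iSup_le (fun ρ => ?_) le_rfl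
  rw [ρ.map_rel r hr, norm_zero]

/-- The subspace spanned by a set stable under left multiplication by the generators and their
adjoints is dense. -/
lemma topologicalClosure_eq_top {S : Submodule ℂ P.Univ} (h1 : 1 ∈ S)
    (hgen : ∀ x, ∀ a ∈ S, gen P x * a ∈ S) (hstar : ∀ x, ∀ a ∈ S, star (gen P x) * a ∈ S) :
    S.topologicalClosure = ⊤ := by
  have hword : ∀ w : FreeMonoid (X ⊕ X), mkHom (P := P) (FreeStarAlgebra.word w) ∈ S := by
    intro w
    -- Letters are added on the left only, so a subspace stable under left multiplication is enough
    -- and no closure under products is needed.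
    induction w using FreeMonoid.recOn with
    | one => rw [map_one, map_one]; exact h1
    | of_mul y w hw =>
      rw [map_mul, map_mul]
      rcases y with x | x
      · exact hgen x _ hw
      · rw [← FreeStarAlgebra.star_gen, map_star]
        exact hstar x _ hw
  have hall : ∀ a : FreeStarAlgebra X, mkHom (P := P) a ∈ S := by
    intro a
    refine MonoidAlgebra.induction_on
      (motive := fun a => mkHom (P := P) (show FreeStarAlgebra X from a) ∈ S) a hword ?_ ?_
    · intro f g hf hg
      exact (map_add (mkHom (P := P)) (show FreeStarAlgebra X from f) g) ▸ S.add_mem hf hg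
    · intro c f hf
      exact (map_smul (mkHom (P := P)) c (show FreeStarAlgebra X from f)) ▸ S.smul_mem c hf
  rw [← Submodule.dense_iff_topologicalClosure_eq_top]
  refine denseRange_mk.mono ?_
  rintro _ ⟨a, rfl⟩
  exact hall a

section Lift

variable {B : Type} [CStarAlgebra B] (f : FreeStarAlgebra X →⋆ₐ[ℂ] B)

/-- A `*`-homomorphism on the free algebra, on the seminormed algebra of a presentation. -/
def preHom (P : CStarPresentation X) : P.Pre →+* B :=
  (RingHomClass.toRingHom f : FreeStarAlgebra X →+* B)

variable {f}

lemma continuous_preHom (hf : ∀ r ∈ P.rels, f r = 0) : Continuous (preHom f P) :=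
  AddMonoidHomClass.continuous_of_bound (preHom f P) 1 fun a => by
    rw [one_mul]
    exact P.le_unorm ⟨B, f, hf⟩ a

/-- The ring homomorphism underlying `lift`. -/
def liftRingHom (hf : ∀ r ∈ P.rels, f r = 0) : P.Univ →+* B :=
  Completion.extensionHom (preHom f P) (continuous_preHom hf)

lemma liftRingHom_mk (hf : ∀ r ∈ P.rels, f r = 0) (a : P.Pre) :
    liftRingHom hf (mk P a) = preHom f P a :=
  Completion.extensionHom_coe _ _ a

lemma continuous_liftRingHom (hf : ∀ r ∈ P.rels, f r = 0) : Continuous (liftRingHom hf) :=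
  Completion.continuous_extension

/-- The `*`-homomorphism from the universal `C*`-algebra given by a representation of the
relations. -/
def lift (hf : ∀ r ∈ P.rels, f r = 0) : P.Univ →⋆ₐ[ℂ] B where
  __ := liftRingHom hf
  commutes' c := (liftRingHom_mk hf (algebraMap ℂ P.Pre c)).trans (AlgHomClass.commutes f c)
  map_star' a := by
    change liftRingHom hf (star a) = star (liftRingHom hf a)
    induction a using Univ.induction_on with
    | hp =>
      exact isClosed_eq ((continuous_liftRingHom hf).comp continuous_star')
        (continuous_liftRingHom hf).star
    | h a =>
      rw [← mk_star, liftRingHom_mk, liftRingHom_mk]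
      exact map_star f a

lemma lift_gen (hf : ∀ r ∈ P.rels, f r = 0) (x : X) :
    lift hf (gen P x) = f (FreeStarAlgebra.gen x) := liftRingHom_mk hf _

end Lift
end CStarPresentation.Univ

/-! ## Noncommutative tori -/

namespace NCTorus

open CStarPresentation

variable {n : ℕ} (Θ : Matrix (Fin n) (Fin n) ℝ)

/-- The canonical unitaries of a noncommutative torus. -/
def u (j : Fin n) : unitary (NCTorus Θ) :=
  ⟨Univ.gen (ncTorusPresentation Θ) j, by
    constructor
    · have h := Univ.mkHom_rel (P := ncTorusPresentation Θ) (Or.inl (Or.inl ⟨j, rfl⟩))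
      rwa [map_sub, map_mul, map_star, map_one, sub_eq_zero] at h
    · have h := Univ.mkHom_rel (P := ncTorusPresentation Θ) (Or.inl (Or.inr ⟨j, rfl⟩))
      rwa [map_sub, map_mul, map_star, map_one, sub_eq_zero] at h⟩

lemma coe_u (j : Fin n) : (u Θ j : NCTorus Θ) = Univ.gen (ncTorusPresentation Θ) j := rfl

lemma u_mul_u (j k : Fin n) : (u Θ j : NCTorus Θ) * u Θ k =
    Complex.exp (2 * Real.pi * Complex.I * Θ j k) • ((u Θ k : NCTorus Θ) * u Θ j) := by
  have h := Univ.mkHom_rel (P := ncTorusPresentation Θ) (Or.inr ⟨j, k, rfl⟩)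
  rwa [map_sub, map_mul, map_smul, map_mul, sub_eq_zero] at h

variable {Θ}

/-- The universal property of a noncommutative torus. -/
lemma exists_lift {B : Type} [CStarAlgebra B] (g : Fin n → unitary B)
    (hg : ∀ j k, (g j : B) * g k =
      Complex.exp (2 * Real.pi * Complex.I * Θ j k) • ((g k : B) * g j)) :
    ∃ π : NCTorus Θ →⋆ₐ[ℂ] B, ∀ j, π (u Θ j) = g j := by
  refine ⟨Univ.lift (f := FreeStarAlgebra.lift fun j => (g j : B)) ?_, fun j => ?_⟩
  · rintro r ((⟨j, rfl⟩ | ⟨j, rfl⟩) | ⟨j, k, rfl⟩)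
    · simp [map_star]
    · simp [map_star]
    · simp [hg j k]
  · rw [coe_u, Univ.lift_gen, FreeStarAlgebra.lift_gen]

end NCTorus

/-! ## Monomials in unitaries commuting up to scalars -/

section Monomials

variable {A : Type*} [CStarAlgebra A]

/-- `x` and `y` commute up to a nonzero scalar. -/
def ScalarCommute (x y : unitary A) : Prop :=
  ∃ c : ℂ, c ≠ 0 ∧ (x : A) * y = c • ((y : A) * x)

lemma ScalarCommute.symm {x y : unitary A} (h : ScalarCommute x y) : ScalarCommute y x := by
  obtain ⟨c, hc, h⟩ := h
  exact ⟨c⁻¹, inv_ne_zero hc, by rw [h, inv_smul_smul₀ hc]⟩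

lemma ScalarCommute.one_right (x : unitary A) : ScalarCommute x 1 := ⟨1, one_ne_zero, by simp⟩

lemma ScalarCommute.mul_right {x y z : unitary A} (hy : ScalarCommute x y)
    (hz : ScalarCommute x z) : ScalarCommute x (y * z) := by
  obtain ⟨c, hc, hy⟩ := hy
  obtain ⟨d, hd, hz⟩ := hz
  refine ⟨c * d, mul_ne_zero hc hd, ?_⟩
  rw [Submonoid.coe_mul, ← mul_assoc, hy, smul_mul_assoc, mul_assoc, hz, mul_smul_comm, smul_smul,
    mul_assoc]

lemma ScalarCommute.inv_right {x y : unitary A} (h : ScalarCommute x y) :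
    ScalarCommute x y⁻¹ := by
  obtain ⟨c, hc, h⟩ := h.symm
  refine ⟨c, hc, ?_⟩
  calc (x : A) * (y⁻¹ : unitary A) = ((y⁻¹ * y : unitary A) : A) * (x * (y⁻¹ : unitary A)) := by
        simp
    _ = (y⁻¹ : unitary A) * ((y : A) * x) * (y⁻¹ : unitary A) := by
        simp only [Submonoid.coe_mul, mul_assoc]
    _ = c • (((y⁻¹ : unitary A) : A) * x * ((y * y⁻¹ : unitary A) : A)) := by
        rw [h]; simp only [mul_smul_comm, smul_mul_assoc, Submonoid.coe_mul, mul_assoc]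
    _ = _ := by simp

lemma ScalarCommute.zpow_right {x y : unitary A} (h : ScalarCommute x y) (m : ℤ) :
    ScalarCommute x (y ^ m) := by
  induction m with
  | zero => simpa using ScalarCommute.one_right x
  | succ m ih => rw [zpow_add_one]; exact ih.mul_right h
  | pred m ih => rw [zpow_sub_one]; exact ih.mul_right h.inv_right

variable {n : ℕ} (u : Fin n → unitary A)

/-- The product of the unitaries `u j ^ k j` along a list. -/
def listMonomial (l : List (Fin n)) (k : Fin n → ℤ) : unitary A := (l.map fun j => u j ^ k j).prod

/-- The monomial `u 0 ^ k 0 * u 1 ^ k 1 * ⋯`. -/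
def unitaryMonomial (k : Fin n → ℤ) : unitary A := listMonomial u (List.finRange n) k

variable {u}

lemma listMonomial_congr {l : List (Fin n)} {k k' : Fin n → ℤ} (h : ∀ j ∈ l, k j = k' j) :
    listMonomial u l k = listMonomial u l k' := by
  unfold listMonomial
  congr 1
  exact List.map_congr_left fun j hj => by rw [h j hj]

/-- The power moves right past the other factors at the cost of scalars, until it meets its own
letter. As the list has no repetition, that is the only exponent to change. -/
lemma exists_zpow_mul_listMonomial (hu : ∀ i j, ScalarCommute (u i) (u j)) {l : List (Fin n)}
    (hl : l.Nodup) {i : Fin n} (hi : i ∈ l) (e : ℤ) (k : Fin n → ℤ) :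
    ∃ c : ℂ, ((u i ^ e : unitary A) : A) * listMonomial u l k =
      c • (listMonomial u l (k + Pi.single i e) : A) := by
  induction l with
  | nil => simp at hi
  | cons j l ih =>
    have hcons : ∀ k, (listMonomial u (j :: l) k : A) =
        ((u j ^ k j : unitary A) : A) * listMonomial u l k := fun k => by simp [listMonomial]
    rw [hcons, hcons]
    by_cases hij : i = j
    · subst hij
      refine ⟨1, ?_⟩
      rw [one_smul, ← mul_assoc, ← Submonoid.coe_mul, ← zpow_add, Pi.add_apply, Pi.single_eq_same,
        add_comm e]
      congr 2
      refine listMonomial_congr fun m hm => ?_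
      have : m ≠ i := fun h => (List.nodup_cons.1 hl).1 (h ▸ hm)
      simp [this]
    · obtain ⟨c, hc⟩ := ih (List.nodup_cons.1 hl).2 ((List.mem_cons.1 hi).resolve_left hij)
      obtain ⟨d, -, hd⟩ := ((hu i j).zpow_right (k j)).symm.zpow_right e |>.symm
      refine ⟨d * c, ?_⟩
      rw [← mul_assoc, hd, smul_mul_assoc, mul_assoc, hc, mul_smul_comm, smul_smul, Pi.add_apply,
        Pi.single_eq_of_ne (Ne.symm hij), add_zero]

lemma exists_zpow_mul_unitaryMonomial (hu : ∀ i j, ScalarCommute (u i) (u j)) (i : Fin n) (e : ℤ)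
    (k : Fin n → ℤ) : ∃ c : ℂ, ((u i ^ e : unitary A) : A) * unitaryMonomial u k =
      c • (unitaryMonomial u (k + Pi.single i e) : A) :=
  exists_zpow_mul_listMonomial hu (List.nodup_finRange n) (List.mem_finRange i) e k

variable {ι : Type*} {v : ι → unitary A} {lam : Circle}

lemma HasWeight.inv {k : ι → ℤ} {x : unitary A} (hx : HasWeight v lam k (x : A)) :
    HasWeight v lam (-k) ((x⁻¹ : unitary A) : A) := hx.star

lemma HasWeight.zpow {k : ι → ℤ} {x : unitary A} (hx : HasWeight v lam k (x : A)) (m : ℤ) :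
    HasWeight v lam (m • k) ((x ^ m : unitary A) : A) := by
  induction m with
  | zero => simpa using HasWeight.one
  | succ m ih => rw [zpow_add_one, add_smul, one_smul]; exact ih.mul hx
  | pred m ih => rw [zpow_sub_one, sub_smul, one_smul, sub_eq_add_neg]; exact ih.mul hx.inv

/-- Weights add under products, and the weights of the factors are the coordinate vectors scaled by
the exponents. -/
lemma hasWeight_unitaryMonomial {v : Fin n → unitary A}
    (hv : ∀ j, HasWeight v lam (Pi.single j 1) (u j : A)) (k : Fin n → ℤ) :
    HasWeight v lam k (unitaryMonomial u k : A) := by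
  have h : ∀ l : List (Fin n), HasWeight v lam (l.map fun j => Pi.single j (k j)).sum
      (listMonomial u l k : A) := by
    intro l
    induction l with
    | nil => simpa [listMonomial] using HasWeight.one
    | cons j l ih =>
      have h1 := ((hv j).zpow (k j)).mul ih
      rw [← Pi.single_smul, smul_eq_mul, mul_one] at h1
      simpa [listMonomial] using h1
  have h2 := h (List.finRange n)
  rwa [← Fin.sum_univ_def, Finset.univ_sum_single] at h2

end Monomials

/-- The range of an injective `*`-homomorphism of `C*`-algebras is closed. -/
lemma isClosed_range_of_injective {A B : Type*} [CStarAlgebra A] [CStarAlgebra B] (π : A →⋆ₐ[ℂ] B)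
    (hπ : Function.Injective π) : IsClosed (π.range : Set B) := by
  have : (π.range : Set B) = Set.range π := rfl
  rw [this]
  exact (NonUnitalStarAlgHom.isometry π hπ).isClosedEmbedding.isClosed_range

/-! ### Dense monomials and a simplicity criterion for noncommutative tori -/

namespace NCTorus

open CStarPresentation

variable {n : ℕ} {Θ : Matrix (Fin n) (Fin n) ℝ}

lemma scalarCommute_u (i j : Fin n) : ScalarCommute (u Θ i) (u Θ j) :=
  ⟨_, Complex.exp_ne_zero _, u_mul_u Θ i j⟩

lemma span_unitaryMonomial_dense :
    (Submodule.span ℂ (Set.range fun k => (unitaryMonomial (u Θ) k : NCTorus Θ))).topologicalClosure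
      = ⊤ := by
  -- The exponents 1 and -1 treat a generator and its adjoint together.
  have key : ∀ (e : ℤ) (j : Fin n) (a : NCTorus Θ),
      a ∈ Submodule.span ℂ (Set.range fun k => (unitaryMonomial (u Θ) k : NCTorus Θ)) →
      ((u Θ j ^ e : unitary (NCTorus Θ)) : NCTorus Θ) * a ∈
        Submodule.span ℂ (Set.range fun k => (unitaryMonomial (u Θ) k : NCTorus Θ)) := by
    intro e j a ha
    refine Submodule.span_induction ?_ ?_ ?_ ?_ ha
    · rintro _ ⟨k, rfl⟩
      obtain ⟨c, hc⟩ := exists_zpow_mul_unitaryMonomial (scalarCommute_u (Θ := Θ)) j e k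
      simp only [hc]
      exact Submodule.smul_mem _ _ (Submodule.subset_span ⟨_, rfl⟩)
    · simp
    · intro x y _ _ hx hy
      rw [mul_add]; exact add_mem hx hy
    · intro c x _ hx
      rw [mul_smul_comm]; exact Submodule.smul_mem _ _ hx
  refine Univ.topologicalClosure_eq_top (Submodule.subset_span ⟨0, ?_⟩) (fun j a ha => ?_)
    (fun j a ha => ?_)
  · simp [unitaryMonomial, listMonomial]
  · have h := key 1 j a ha
    rwa [zpow_one] at h
  · have h := key (-1) j a ha
    rwa [zpow_neg_one] at h

/-- The generators of a noncommutative torus generate it topologically. -/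
lemma eq_top_of_u_mem {S : StarSubalgebra ℂ (NCTorus Θ)} (hS : IsClosed (S : Set (NCTorus Θ)))
    (hu : ∀ j, (u Θ j : NCTorus Θ) ∈ S) : S = ⊤ := by
  have h := Univ.topologicalClosure_eq_top (S := Subalgebra.toSubmodule S.toSubalgebra) (one_mem S)
    (fun j a ha => S.mul_mem (hu j) ha) (fun j a ha => S.mul_mem (star_mem (hu j) : star _ ∈ S) ha)
  rw [IsClosed.submodule_topologicalClosure_eq hS] at h
  rw [eq_top_iff]
  intro x _
  exact (h ▸ Submodule.mem_top : x ∈ Subalgebra.toSubmodule S.toSubalgebra)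

/-- The range of an injective `*`-homomorphism is the `C*`-algebra generated by the images of the
generators. -/
lemma range_eq_topologicalClosure_adjoin {B : Type} [CStarAlgebra B] {π : NCTorus Θ →⋆ₐ[ℂ] B}
    (hπ : Function.Injective π) {s : Set B} (hs : s = Set.range fun j => π (u Θ j)) :
    π.range = (StarAlgebra.adjoin ℂ s).topologicalClosure := by
  subst hs
  refine le_antisymm ?_ ?_
  -- The preimage of the generated algebra is a closed `*`-subalgebra containing the generators.
  · have htop := eq_top_of_u_mem (Θ := Θ)
      (S := (StarAlgebra.adjoin ℂ (Set.range fun j => π (u Θ j))).topologicalClosure.comap π)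
      ((StarSubalgebra.isClosed_topologicalClosure _).preimage
        (NonUnitalStarAlgHom.isometry π hπ).continuous)
      (fun j => StarSubalgebra.le_topologicalClosure _ (StarAlgebra.subset_adjoin ℂ _ ⟨j, rfl⟩))
    rintro _ ⟨a, rfl⟩
    exact (htop ▸ StarSubalgebra.mem_top :
      a ∈ (StarAlgebra.adjoin ℂ (Set.range fun j => π (u Θ j))).topologicalClosure.comap π)
  · refine StarSubalgebra.topologicalClosure_minimal (StarAlgebra.adjoin_le ?_)
      (isClosed_range_of_injective π hπ)
    rintro _ ⟨j, rfl⟩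
    exact ⟨_, rfl⟩

/-- Simplicity of a noncommutative torus with sufficiently many inner gauge automorphisms. -/
lemma injective_of_hasWeight {C : Type*} [CStarAlgebra C] [Nontrivial C] {lam : Circle}
    (hlam : ∀ i : ℤ, lam ^ i = 1 → i = 0) {v : Fin n → unitary (NCTorus Θ)}
    (hv : ∀ j, HasWeight v lam (Pi.single j 1) (u Θ j : NCTorus Θ)) (π : NCTorus Θ →⋆ₐ[ℂ] C) :
    Function.Injective π :=
  _root_.injective_of_hasWeight hlam (hasWeight_unitaryMonomial hv)
    (fun _ => Unitary.coe_mul_star_self _) span_unitaryMonomial_dense π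

end NCTorus

/-! ### Irrationality and the inner gauge automorphisms -/

section Irrational

variable {θ : ℝ}

/-- If λ^i = 1 then iθ is an integer, so θ would be rational unless i = 0. -/
lemma circleExp_zpow_eq_one (hθ : Irrational θ) {i : ℤ}
    (h : Circle.exp (2 * Real.pi * θ) ^ i = 1) : i = 0 := by
  rw [← Circle.exp_zsmul, Circle.exp_eq_one] at h
  obtain ⟨m, hm⟩ := h
  by_contra hi
  refine hθ ⟨(m : ℚ) / i, ?_⟩
  have hi' : (i : ℝ) ≠ 0 := by exact_mod_cast hi
  push_cast
  rw [div_eq_iff hi']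
  have hpi := Real.pi_pos.ne'
  simp only [zsmul_eq_mul] at hm
  have : (2 * Real.pi) * (m : ℝ) = (2 * Real.pi) * (θ * i) := by linarith
  exact mul_left_cancel₀ (by positivity) this

lemma hasWeight_apply_of_mul_eq {A : Type*} [CStarAlgebra A] {x y : unitary A} {c : ℂ}
    (h : (x : A) * y = c • ((y : A) * x)) : (x : A) * y * star (x : A) = c • (y : A) := by
  rw [h, smul_mul_assoc, mul_assoc, Unitary.mul_star_self_of_mem x.2, mul_one]

lemma inv_mul_mul_of_mul_eq {A : Type*} [CStarAlgebra A] {x y : unitary A} {c : ℂ}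
    (h : (x : A) * y = c • ((y : A) * x)) :
    ((y⁻¹ : unitary A) : A) * x * star ((y⁻¹ : unitary A) : A) = c • (x : A) := by
  change star (y : A) * x * star (star (y : A)) = _
  rw [star_star, mul_assoc, h, mul_smul_comm, ← mul_assoc,
    Unitary.coe_star_mul_self, one_mul]

/-- The matrix of the rotation algebra. -/
abbrev rotationMatrix (θ : ℝ) : Matrix (Fin 2) (Fin 2) ℝ := !![0, θ; -θ, 0]

/-- The matrix of the tensor square of the rotation algebra. -/
abbrev doubleRotationMatrix (θ : ℝ) : Matrix (Fin 4) (Fin 4) ℝ :=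
  !![0, θ, 0, 0; -θ, 0, 0, 0; 0, 0, 0, θ; 0, 0, -θ, 0]

variable (θ) in
lemma exp_eq_coe_circleExp : Complex.exp (2 * Real.pi * Complex.I * θ) =
    (Circle.exp (2 * Real.pi * θ) : ℂ) := by
  rw [Circle.coe_exp]; push_cast; congr 1; ring

namespace NCTorus

variable {n : ℕ} {Θ : Matrix (Fin n) (Fin n) ℝ}

lemma conj_u (i j : Fin n) : (u Θ i : NCTorus Θ) * u Θ j * star (u Θ i : NCTorus Θ) =
    (Circle.exp (2 * Real.pi * Θ i j) : ℂ) • (u Θ j : NCTorus Θ) := by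
  rw [← exp_eq_coe_circleExp]
  exact hasWeight_apply_of_mul_eq (u_mul_u Θ i j)

lemma conj_u_inv (i j : Fin n) : (((u Θ i)⁻¹ : unitary (NCTorus Θ)) : NCTorus Θ) * u Θ j *
    star (((u Θ i)⁻¹ : unitary (NCTorus Θ)) : NCTorus Θ) =
    (Circle.exp (2 * Real.pi * Θ j i) : ℂ) • (u Θ j : NCTorus Θ) := by
  rw [← exp_eq_coe_circleExp]
  exact inv_mul_mul_of_mul_eq (u_mul_u Θ j i)

variable (θ) in
-- From UV = λVU: Ad V* multiplies U by λ and fixes V, while Ad U multiplies V by λ and fixes U. The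
-- inverse on V makes both eigenvalues λ rather than λ⁻¹.
lemma hasWeight_rotation (j : Fin 2) :
    HasWeight ![(u (rotationMatrix θ) 1)⁻¹, u (rotationMatrix θ) 0] (Circle.exp (2 * Real.pi * θ))
      (Pi.single j 1) (u (rotationMatrix θ) j : NCTorus (rotationMatrix θ)) := by
  intro i
  fin_cases i <;> fin_cases j <;>
    simp [conj_u, conj_u_inv]

variable (θ) in
lemma hasWeight_doubleRotation (j : Fin 4) :
    HasWeight ![(u (doubleRotationMatrix θ) 1)⁻¹, u (doubleRotationMatrix θ) 0,
      (u (doubleRotationMatrix θ) 3)⁻¹, u (doubleRotationMatrix θ) 2]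
      (Circle.exp (2 * Real.pi * θ)) (Pi.single j 1)
      (u (doubleRotationMatrix θ) j : NCTorus (doubleRotationMatrix θ)) := by
  intro i
  fin_cases i <;> fin_cases j <;>
    simp [conj_u, conj_u_inv]

/-- Two commuting pairs of unitaries satisfying the relation of the rotation algebra satisfy the
relations of the noncommutative torus of `doubleRotationMatrix θ`. -/
lemma doubleRotation_relations {B : Type*} [CStarAlgebra B] (g : Fin 4 → unitary B)
    (h01 : (g 0 : B) * g 1 = (Circle.exp (2 * Real.pi * θ) : ℂ) • ((g 1 : B) * g 0))
    (h23 : (g 2 : B) * g 3 = (Circle.exp (2 * Real.pi * θ) : ℂ) • ((g 3 : B) * g 2))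
    (h02 : (g 0 : B) * g 2 = g 2 * g 0) (h03 : (g 0 : B) * g 3 = g 3 * g 0)
    (h12 : (g 1 : B) * g 2 = g 2 * g 1) (h13 : (g 1 : B) * g 3 = g 3 * g 1) (j k : Fin 4) :
    (g j : B) * g k = Complex.exp (2 * Real.pi * Complex.I * doubleRotationMatrix θ j k) •
      ((g k : B) * g j) := by
  rw [exp_eq_coe_circleExp]
  have hneg : Circle.exp (-(2 * Real.pi * θ)) = (Circle.exp (2 * Real.pi * θ))⁻¹ :=
    Circle.exp_neg _
  fin_cases j <;> fin_cases k <;>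
    simp [h01, h23, h02, h03, h12, h13, hneg]

/-- The noncommutative torus of `doubleRotationMatrix θ` is simple. -/
lemma injective_doubleRotation {C : Type*} [CStarAlgebra C] [Nontrivial C] (hθ : Irrational θ)
    (π : NCTorus (doubleRotationMatrix θ) →⋆ₐ[ℂ] C) : Function.Injective π :=
  injective_of_hasWeight (fun _ => circleExp_zpow_eq_one hθ) (hasWeight_doubleRotation θ) π

end NCTorus

end Irrational

/-! ## Weighted permutation operators on `ℓ²` -/

section WeightedPerm

variable {K : Type}

/-- The Hilbert space `ℓ²(K)`. -/
abbrev EllTwo (K : Type) : Type := lp (fun _ : K => ℂ) 2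

lemma sum_weightedPerm_le (f : K → ℂ) {C : ℝ} (hf : ∀ k, ‖f k‖ ≤ C) (e : K ≃ K)
    (ξ : EllTwo K) (s : Finset K) :
    ∑ k ∈ s, ‖f k * ξ (e k)‖ ^ (2 : ENNReal).toReal ≤ (C * ‖ξ‖) ^ (2 : ENNReal).toReal := by
  have h := lp.sum_rpow_le_norm_rpow (p := 2) (by norm_num) ξ (s.map e.toEmbedding)
  rw [Finset.sum_map] at h
  simp only [ENNReal.toReal_ofNat, Real.rpow_ofNat, Equiv.coe_toEmbedding] at h ⊢
  calc ∑ k ∈ s, ‖f k * ξ (e k)‖ ^ 2 ≤ ∑ k ∈ s, C ^ 2 * ‖ξ (e k)‖ ^ 2 := by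
        refine Finset.sum_le_sum fun k _ => ?_
        rw [norm_mul, mul_pow]
        gcongr
        exact hf k
    _ = C ^ 2 * ∑ k ∈ s, ‖ξ (e k)‖ ^ 2 := by rw [Finset.mul_sum]
    _ ≤ _ := by rw [mul_pow]; gcongr

/-- The operator `(T ξ) k = f k * ξ (e k)` on `ℓ²(K)`. -/
def weightedPerm (f : K → ℂ) (C : ℝ) (hC : 0 ≤ C) (hf : ∀ k, ‖f k‖ ≤ C) (e : K ≃ K) :
    EllTwo K →L[ℂ] EllTwo K :=
  LinearMap.mkContinuous
    { toFun := fun ξ => ⟨fun k => f k * ξ (e k), memℓp_gen' (sum_weightedPerm_le f hf e ξ)⟩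
      map_add' := fun ξ η => by ext k; exact mul_add _ _ _
      map_smul' := fun c ξ => by ext k; exact mul_left_comm _ _ _ }
    C fun ξ => lp.norm_le_of_forall_sum_le (by norm_num) (by positivity)
      (sum_weightedPerm_le f hf e ξ)

@[simp]
lemma weightedPerm_apply (f : K → ℂ) (C : ℝ) (hC : 0 ≤ C) (hf : ∀ k, ‖f k‖ ≤ C) (e : K ≃ K)
    (ξ : EllTwo K) (k : K) : weightedPerm f C hC hf e ξ k = f k * ξ (e k) := rfl

lemma star_weightedPerm (f : K → ℂ) (C : ℝ) (hC : 0 ≤ C) (hf : ∀ k, ‖f k‖ ≤ C) (e : K ≃ K) :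
    star (weightedPerm f C hC hf e) = weightedPerm (fun k => star (f (e.symm k))) C hC
      (fun k => by rw [norm_star]; exact hf _) e.symm := by
  rw [ContinuousLinearMap.star_eq_adjoint]
  symm
  rw [ContinuousLinearMap.eq_adjoint_iff]
  intro ξ η
  rw [lp.inner_eq_tsum, lp.inner_eq_tsum, ← e.tsum_eq]
  refine tsum_congr fun k => ?_
  simp
  ring

end WeightedPerm

/-! ## The crossed product by the double rotation -/

section DoubleRotation

variable (θ : ℝ)

/-- The orbit of `(1, 1)` under the double rotation. -/
def orbitPoint (k : ℤ × ℤ) : Circle × Circle := torusRotation θ (-k) (1, 1)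

lemma torusRotation_orbitPoint (g k : ℤ × ℤ) :
    torusRotation θ g (orbitPoint θ k) = orbitPoint θ (k - g) := by
  rw [orbitPoint, orbitPoint, ← ContinuousMap.comp_apply, ← torusRotation_add]
  congr 2; abel

lemma doubleRotation_apply (g : Multiplicative (ℤ × ℤ)) (f : C(Circle × Circle, ℂ))
    (z : Circle × Circle) : doubleRotation θ g f z = f (torusRotation θ g.toAdd z) := rfl

/-- The covariant representation on `ℓ²(ℤ²)` induced by the point `(1, 1)`, on generators. -/
def orbitRep : C(Circle × Circle, ℂ) ⊕ Multiplicative (ℤ × ℤ) →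
    (EllTwo (ℤ × ℤ) →L[ℂ] EllTwo (ℤ × ℤ))
  | Sum.inl f => weightedPerm (fun k => f (orbitPoint θ k)) ‖f‖ (norm_nonneg _)
      (fun _ => f.norm_coe_le_norm _) (Equiv.refl _)
  | Sum.inr g => weightedPerm (fun _ => 1) 1 zero_le_one (fun _ => by simp)
      (Equiv.subRight g.toAdd)

/-- Functions act diagonally by their values along the orbit and group elements by shifts.
Covariance holds because rotating the orbit point of index k by g gives that of index k - g. -/
lemma lift_orbitRep_eq_zero (r : FreeStarAlgebra (C(Circle × Circle, ℂ) ⊕ Multiplicative (ℤ × ℤ)))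
    (hr : CovarianceRel (doubleRotation θ) r) : FreeStarAlgebra.lift (orbitRep θ) r = 0 := by
  cases hr <;> simp only [coeffGen, unitaryGen, map_sub, map_mul, map_star, map_add, map_smul,
    map_one, FreeStarAlgebra.lift_gen, sub_eq_zero, orbitRep, star_weightedPerm] <;> ext ξ k
  all_goals simp [add_mul, mul_assoc, doubleRotation_apply, torusRotation_orbitPoint]
  -- Only multiplicativity of the shifts is left: k - g - h = k - (g + h).
  rw [sub_sub]

instance : Nontrivial (EllTwo (ℤ × ℤ)) :=
  ⟨⟨lp.single 2 0 1, 0, fun h => by simpa using congrArg (fun ξ : EllTwo (ℤ × ℤ) => ξ 0) h⟩⟩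

/-- The orbit representation is a unital map to a nonzero algebra. Without nontriviality the
simplicity argument could not be applied to this target. -/
instance : Nontrivial (CrossedProduct (doubleRotation θ)) := by
  let π : CrossedProduct (doubleRotation θ) →⋆ₐ[ℂ] (EllTwo (ℤ × ℤ) →L[ℂ] EllTwo (ℤ × ℤ)) :=
    CStarPresentation.Univ.lift (lift_orbitRep_eq_zero θ)
  exact π.toRingHom.domain_nontrivial

end DoubleRotation

/-! ### Coefficients and group unitaries of a crossed product -/

namespace CrossedProduct

open CStarPresentation

variable {A : Type} [CStarAlgebra A] {G : Type} [Group G] (α : G →* (A ≃⋆ₐ[ℂ] A))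

/-- The coefficient algebra in the crossed product. -/
def coeff : A →⋆ₐ[ℂ] CrossedProduct α where
  __ := coeffHom (α := α) (Univ.mkHom (P := crossedProductPresentation α)) fun _ hr =>
    Univ.mkHom_rel (P := crossedProductPresentation α) hr
  map_one' := by
    have h := Univ.mkHom_rel (P := crossedProductPresentation α) (CovarianceRel.one)
    rwa [map_sub, map_one, sub_eq_zero] at h
  commutes' c := by
    have h := Univ.mkHom_rel (P := crossedProductPresentation α) (CovarianceRel.smul c 1)
    have h1 := Univ.mkHom_rel (P := crossedProductPresentation α) (CovarianceRel.one)
    rw [map_sub, map_one, sub_eq_zero] at h1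
    rw [map_sub, map_smul, sub_eq_zero, h1] at h
    rw [Algebra.algebraMap_eq_smul_one, Algebra.algebraMap_eq_smul_one]
    exact h

/-- The group unitaries of the crossed product. -/
def groupUnitary : G →* unitary (CrossedProduct α) :=
  MonoidHom.mk' (fun g => ⟨Univ.gen (crossedProductPresentation α) (Sum.inr g), by
    constructor
    · have h := Univ.mkHom_rel (P := crossedProductPresentation α) (CovarianceRel.unitary_left g)
      rwa [map_sub, map_mul, map_star, map_one, sub_eq_zero] at h
    · have h := Univ.mkHom_rel (P := crossedProductPresentation α) (CovarianceRel.unitary_right g)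
      rwa [map_sub, map_mul, map_star, map_one, sub_eq_zero] at h⟩) fun g h => by
    have h := Univ.mkHom_rel (P := crossedProductPresentation α) (CovarianceRel.group_mul g h)
    rw [map_sub, map_mul, sub_eq_zero] at h
    exact Subtype.ext h

lemma groupUnitary_mul_coeff (g : G) (a : A) :
    (groupUnitary α g : CrossedProduct α) * coeff α a = coeff α (α g a) * groupUnitary α g := by
  have h := Univ.mkHom_rel (P := crossedProductPresentation α) (CovarianceRel.covariant g a)
  rw [map_sub, map_mul, map_mul, map_star, sub_eq_zero] at h
  change (groupUnitary α g : CrossedProduct α) * coeff α a * star (groupUnitary α g : CrossedProduct α)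
    = coeff α (α g a) at h
  rw [← h, mul_assoc, Unitary.coe_star_mul_self, mul_one]

/-- A closed `*`-subalgebra containing the coefficients and the group unitaries is everything. -/
lemma eq_top_of_mem {S : StarSubalgebra ℂ (CrossedProduct α)} (hS : IsClosed (S : Set (CrossedProduct α)))
    (hc : ∀ a, coeff α a ∈ S) (hg : ∀ g, (groupUnitary α g : CrossedProduct α) ∈ S) : S = ⊤ := by
  have hgen : ∀ x, Univ.gen (crossedProductPresentation α) x ∈ S := by
    rintro (a | g)
    · exact hc a
    · exact hg g
  have h := Univ.topologicalClosure_eq_top (S := Subalgebra.toSubmodule S.toSubalgebra) (one_mem S)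
    (fun x a ha => S.mul_mem (hgen x) ha) (fun x a ha => S.mul_mem (star_mem (hgen x) : star _ ∈ S) ha)
  rw [IsClosed.submodule_topologicalClosure_eq hS] at h
  rw [eq_top_iff]
  intro x _
  exact (h ▸ Submodule.mem_top : x ∈ Subalgebra.toSubmodule S.toSubalgebra)

end CrossedProduct

/-! ### Stone–Weierstrass on the two-torus -/

section Torus

/-- The first coordinate function on the torus, as a unitary. -/
def torusCoord₁ : unitary C(Circle × Circle, ℂ) :=
  ⟨⟨fun z => z.1, by fun_prop⟩, by constructor <;> ext z <;> simp [← Circle.coe_inv_eq_conj]⟩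

/-- The second coordinate function on the torus, as a unitary. -/
def torusCoord₂ : unitary C(Circle × Circle, ℂ) :=
  ⟨⟨fun z => z.2, by fun_prop⟩, by constructor <;> ext z <;> simp [← Circle.coe_inv_eq_conj]⟩

lemma torusCoord₁_apply (z : Circle × Circle) :
    (torusCoord₁ : C(Circle × Circle, ℂ)) z = z.1 := rfl

lemma torusCoord₂_apply (z : Circle × Circle) :
    (torusCoord₂ : C(Circle × Circle, ℂ)) z = z.2 := rfl

/-- A closed `*`-subalgebra of `C(𝕋²)` containing the coordinates is everything. -/
lemma eq_top_of_torusCoord_mem {S : StarSubalgebra ℂ C(Circle × Circle, ℂ)}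
    (hS : IsClosed (S : Set C(Circle × Circle, ℂ)))
    (h1 : (torusCoord₁ : C(Circle × Circle, ℂ)) ∈ S)
    (h2 : (torusCoord₂ : C(Circle × Circle, ℂ)) ∈ S) : S = ⊤ := by
  have h := ContinuousMap.starSubalgebra_topologicalClosure_eq_top_of_separatesPoints S ?_
  · rw [← h]
    exact le_antisymm S.le_topologicalClosure (S.topologicalClosure_minimal le_rfl hS)
  · intro z w hzw
    by_cases h : z.1 = w.1
    · refine ⟨_, ⟨_, h2, rfl⟩, fun h' => hzw (Prod.ext h (Circle.ext h'))⟩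
    · exact ⟨_, ⟨_, h1, rfl⟩, fun h' => h (Circle.ext h')⟩

end Torus

/-! ### The crossed product as a noncommutative torus -/

section CrossedProductIso

open CStarPresentation CrossedProduct

variable {θ : ℝ}

/-- The unitary of the crossed product given by a unitary coefficient. -/
def coeffUnitary {A : Type} [CStarAlgebra A] {G : Type} [Group G] (α : G →* (A ≃⋆ₐ[ℂ] A))
    (a : unitary A) : unitary (CrossedProduct α) :=
  ⟨coeff α a, Unitary.map_mem (coeff α) a.2⟩

variable (θ) in
/-- The unitaries in the crossed product that satisfy the relations of the noncommutative torus. -/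
def crossedProductUnitary : Fin 4 → unitary (CrossedProduct (doubleRotation θ)) :=
  ![coeffUnitary _ torusCoord₁, groupUnitary _ (.ofAdd (1, 0)),
    coeffUnitary _ torusCoord₂, groupUnitary _ (.ofAdd (0, 1))]

/-- Covariance turns an eigenfunction of the action into a scalar commutation relation. Both orders
are recorded because the torus relations, in the chosen order of generators, use both. -/
lemma coeff_mul_groupUnitary_of_eigen {g : Multiplicative (ℤ × ℤ)}
    {a : C(Circle × Circle, ℂ)} {c d : ℂ} (hcd : d * c = 1) (h : doubleRotation θ g a = c • a) :
    (groupUnitary (doubleRotation θ) g : CrossedProduct (doubleRotation θ)) *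
      coeff (doubleRotation θ) a =
        c • (coeff (doubleRotation θ) a * groupUnitary (doubleRotation θ) g) ∧
    coeff (doubleRotation θ) a * groupUnitary (doubleRotation θ) g =
      d • ((groupUnitary (doubleRotation θ) g : CrossedProduct (doubleRotation θ)) *
        coeff (doubleRotation θ) a) := by
  have h1 : (groupUnitary (doubleRotation θ) g : CrossedProduct (doubleRotation θ)) *
      coeff (doubleRotation θ) a =
        c • (coeff (doubleRotation θ) a * groupUnitary (doubleRotation θ) g) := by
    rw [groupUnitary_mul_coeff, h, map_smul, smul_mul_assoc]
  exact ⟨h1, by rw [h1, smul_smul, hcd, one_smul]⟩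

variable (θ) in
lemma crossedProductUnitary_mul (j k : Fin 4) :
    (crossedProductUnitary θ j : CrossedProduct (doubleRotation θ)) * crossedProductUnitary θ k =
      Complex.exp (2 * Real.pi * Complex.I * doubleRotationMatrix θ j k) •
        ((crossedProductUnitary θ k : CrossedProduct (doubleRotation θ)) *
          crossedProductUnitary θ j) := by
  -- The action of (1, 0) multiplies the first coordinate by λ⁻¹, so placing the coordinate before
  -- the group unitary gives the factor λ, as required for +θ.
  have h11 := coeff_mul_groupUnitary_of_eigen (θ := θ) (g := .ofAdd (1, 0)) (a := torusCoord₁)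
    (c := ((Circle.exp (2 * Real.pi * θ))⁻¹ : Circle)) (d := Circle.exp (2 * Real.pi * θ))
    (by simp) (by ext z; simp [doubleRotation_apply, torusCoord₁_apply, torusRotation])
  have h12 := coeff_mul_groupUnitary_of_eigen (θ := θ) (g := .ofAdd (1, 0)) (a := torusCoord₂)
    (c := 1) (d := 1)
    (by simp) (by ext z; simp [doubleRotation_apply, torusCoord₂_apply, torusRotation])
  have h21 := coeff_mul_groupUnitary_of_eigen (θ := θ) (g := .ofAdd (0, 1)) (a := torusCoord₁)
    (c := 1) (d := 1)
    (by simp) (by ext z; simp [doubleRotation_apply, torusCoord₁_apply, torusRotation])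
  have h22 := coeff_mul_groupUnitary_of_eigen (θ := θ) (g := .ofAdd (0, 1)) (a := torusCoord₂)
    (c := ((Circle.exp (2 * Real.pi * θ))⁻¹ : Circle)) (d := Circle.exp (2 * Real.pi * θ))
    (by simp) (by ext z; simp [doubleRotation_apply, torusCoord₂_apply, torusRotation])
  have hz : coeff (doubleRotation θ) torusCoord₁ * coeff (doubleRotation θ) torusCoord₂ =
      coeff (doubleRotation θ) torusCoord₂ * coeff (doubleRotation θ) torusCoord₁ := by
    rw [← map_mul, mul_comm, map_mul]
  have hg : (groupUnitary (doubleRotation θ) (.ofAdd (1, 0)) : CrossedProduct (doubleRotation θ)) *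
      groupUnitary (doubleRotation θ) (.ofAdd (0, 1)) =
      (groupUnitary (doubleRotation θ) (.ofAdd (0, 1)) : CrossedProduct (doubleRotation θ)) *
      groupUnitary (doubleRotation θ) (.ofAdd (1, 0)) := by
    rw [← Submonoid.coe_mul, ← map_mul, mul_comm, map_mul, Submonoid.coe_mul]
  exact NCTorus.doubleRotation_relations (crossedProductUnitary θ) h11.2 h22.2 hz
    (h21.2.trans (one_smul _ _)) (h12.1.trans (one_smul _ _)) hg j k

/-- The noncommutative torus is isomorphic to the crossed product by the double rotation. -/
lemma exists_ncTorus_equiv_crossedProduct (hθ : Irrational θ) :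
    Nonempty (NCTorus (doubleRotationMatrix θ) ≃⋆ₐ[ℂ] CrossedProduct (doubleRotation θ)) := by
  obtain ⟨π, hπ⟩ := NCTorus.exists_lift (crossedProductUnitary θ) (crossedProductUnitary_mul θ)
  have hinj := NCTorus.injective_doubleRotation hθ π
  have hmem : ∀ j, (crossedProductUnitary θ j : CrossedProduct (doubleRotation θ)) ∈ π.range :=
    fun j => ⟨_, hπ j⟩
  have hclosed := isClosed_range_of_injective π hinj
  -- The coefficients whose image lies in the range form a closed `*`-subalgebra containing both
  -- coordinates, hence all of C(𝕋²).
  have hcoeff : π.range.comap (coeff (doubleRotation θ)) = ⊤ :=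
    eq_top_of_torusCoord_mem
      (hclosed.preimage (AddMonoidHomClass.continuous_of_bound (coeff (doubleRotation θ)) 1
        fun x => by simpa using NonUnitalStarAlgHom.norm_apply_le (coeff (doubleRotation θ)) x))
      (hmem 0) (hmem 2)
  -- Membership in the range defines a subgroup of the unitaries, so two generators of ℤ² suffice.
  let T : Subgroup (unitary (CrossedProduct (doubleRotation θ))) :=
    { carrier := {x | (x : CrossedProduct (doubleRotation θ)) ∈ π.range}
      mul_mem' := fun {x y} hx hy => (mul_mem hx hy :
        (x : CrossedProduct (doubleRotation θ)) * y ∈ π.range)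
      one_mem' := (one_mem π.range : (1 : CrossedProduct (doubleRotation θ)) ∈ π.range)
      inv_mem' := fun {x} hx => (star_mem hx :
        star (x : CrossedProduct (doubleRotation θ)) ∈ π.range) }
  have hgroup : ∀ g, groupUnitary (doubleRotation θ) g ∈ T := by
    intro g
    have : g = (Multiplicative.ofAdd ((1 : ℤ), (0 : ℤ))) ^ (g.toAdd.1) *
        (Multiplicative.ofAdd ((0 : ℤ), (1 : ℤ))) ^ (g.toAdd.2) := by
      rw [← ofAdd_zsmul, ← ofAdd_zsmul, ← ofAdd_add]
      simp
    rw [this, map_mul, map_zpow, map_zpow]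
    exact T.mul_mem (T.zpow_mem (hmem 1) _) (T.zpow_mem (hmem 3) _)
  have htop : π.range = ⊤ := CrossedProduct.eq_top_of_mem _ hclosed
    (fun a => (hcoeff ▸ StarSubalgebra.mem_top : a ∈ π.range.comap (coeff (doubleRotation θ))))
    hgroup
  refine ⟨StarAlgEquiv.ofBijective π ⟨hinj, fun x => ?_⟩⟩
  exact (htop ▸ StarSubalgebra.mem_top : x ∈ π.range)

end CrossedProductIso

/-! ## The trace of the rotation algebra -/

section Positivity

variable {A : Type*} [CStarAlgebra A]

/-- Shifting by it gives (Im φ(a) + t)² ≤ ‖a + it‖² ≤ ‖a‖² + t² for all real t. The term linear in t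
is unbounded unless Im φ(a) = 0. -/
lemma im_eq_zero_of_norm_le_one [Nontrivial A] {φ : A →L[ℂ] ℂ} (hφ : ‖φ‖ ≤ 1) (hφ1 : φ 1 = 1)
    {a : A} (ha : IsSelfAdjoint a) : (φ a).im = 0 := by
  have key : ∀ t : ℝ, ((φ a).im + t) ^ 2 ≤ ‖a‖ ^ 2 + t ^ 2 := by
    intro t
    have h1 : star (a + (t * Complex.I : ℂ) • (1 : A)) * (a + (t * Complex.I : ℂ) • (1 : A)) =
        a * a + ((t ^ 2 : ℝ) : ℂ) • (1 : A) := by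
      have h2 : ((t ^ 2 : ℝ) : ℂ) = -((t * Complex.I) * (t * Complex.I)) := by
        push_cast; ring_nf; simp
      rw [h2]
      simp only [star_add, star_smul, star_one, ha.star_eq, add_mul, mul_add, smul_mul_assoc,
        mul_smul_comm, one_mul, mul_one, neg_smul]
      have h3 : star ((t : ℂ) * Complex.I) = -(t * Complex.I) := by simp
      rw [h3]
      simp only [neg_smul, smul_add, smul_neg, smul_smul]
      abel
    have h4 : ‖a + (t * Complex.I : ℂ) • (1 : A)‖ ^ 2 ≤ ‖a‖ ^ 2 + t ^ 2 := by
      rw [sq, ← CStarRing.norm_star_mul_self, h1]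
      refine (norm_add_le _ _).trans (add_le_add ?_ ?_)
      · rw [sq]; exact norm_mul_le _ _
      · rw [norm_smul, CStarRing.norm_one, mul_one, Complex.norm_real, Real.norm_of_nonneg (by positivity)]
    have h5 : ‖φ (a + (t * Complex.I : ℂ) • (1 : A))‖ ≤ ‖a + (t * Complex.I : ℂ) • (1 : A)‖ :=
      (φ.le_opNorm _).trans (mul_le_of_le_one_left (norm_nonneg _) hφ)
    have h6 : ((φ a).im + t) = (φ (a + (t * Complex.I : ℂ) • (1 : A))).im := by
      simp [hφ1]
    rw [h6]
    refine le_trans ?_ h4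
    rw [← sq_abs]
    gcongr
    exact (Complex.abs_im_le_norm _).trans h5
  by_contra h
  -- This t makes the cross term 2t Im φ(a) equal to ‖a‖² + 1, which exceeds the permitted ‖a‖².
  have h0 := key ((‖a‖ ^ 2 + 1) / (2 * (φ a).im))
  have : 2 * (φ a).im * ((‖a‖ ^ 2 + 1) / (2 * (φ a).im)) = ‖a‖ ^ 2 + 1 := by field_simp
  nlinarith [sq_nonneg (φ a).im]

/-- A unital functional of norm at most one is positive. -/
lemma nonneg_of_norm_le_one [Nontrivial A] [PartialOrder A] [StarOrderedRing A] {φ : A →L[ℂ] ℂ}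
    (hφ : ‖φ‖ ≤ 1) (hφ1 : φ 1 = 1) {a : A} (ha : 0 ≤ a) : 0 ≤ φ a := by
  rw [Complex.nonneg_iff]
  refine ⟨?_, (im_eq_zero_of_norm_le_one hφ hφ1 (.of_nonneg ha)).symm⟩
  have h1 : a ≤ algebraMap ℝ A ‖a‖ := IsSelfAdjoint.le_algebraMap_norm_self (.of_nonneg ha)
  -- From 0 ≤ ‖a‖ - a ≤ ‖a‖ the distance from φ(a) to ‖a‖ is at most ‖a‖, so the real part of φ(a)
  -- is nonnegative.
  have h2 : ‖algebraMap ℝ A ‖a‖ - a‖ ≤ ‖algebraMap ℝ A ‖a‖‖ :=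
    CStarAlgebra.norm_le_norm_of_nonneg_of_le (sub_nonneg.2 h1) (sub_le_self _ ha)
  have h3 : φ (algebraMap ℝ A ‖a‖ - a) = ‖a‖ - φ a := by
    rw [map_sub, Algebra.algebraMap_eq_smul_one, ← Complex.coe_smul, map_smul, hφ1, smul_eq_mul,
      mul_one]
  have h4 := ((φ.le_opNorm _).trans (mul_le_of_le_one_left (norm_nonneg _) hφ)).trans h2
  rw [h3, norm_algebraMap', norm_norm] at h4
  have h5 := (Complex.re_le_norm _).trans h4
  simp only [Complex.sub_re, Complex.ofReal_re] at h5
  linarith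

end Positivity

/-! ### Existence, uniqueness and faithfulness of the trace -/

namespace RotationAlgebra

open CStarPresentation NCTorus

variable {θ : ℝ}

/-- The first pair of unitaries in the nonzero crossed product satisfies the rotation relation. -/
instance : Nontrivial (RotationAlgebra θ) := by
  obtain ⟨π, -⟩ := NCTorus.exists_lift (Θ := rotationMatrix θ)
    ![crossedProductUnitary θ 0, crossedProductUnitary θ 1] (by
      intro j k
      have h := crossedProductUnitary_mul θ (Fin.castLE (by norm_num) j) (Fin.castLE (by norm_num) k)
      fin_cases j <;> fin_cases k <;> first | (simp; done) | simpa using h)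
  exact π.toRingHom.domain_nontrivial

variable (θ) in
/-- The unitaries implementing the gauge automorphisms. -/
def gaugeUnitary : Fin 2 → unitary (RotationAlgebra θ) :=
  ![(u (rotationMatrix θ) 1)⁻¹, u (rotationMatrix θ) 0]

lemma hasWeight_monomial (k : Fin 2 → ℤ) :
    HasWeight (gaugeUnitary θ) (Circle.exp (2 * Real.pi * θ)) k
      (unitaryMonomial (u (rotationMatrix θ)) k : RotationAlgebra θ) :=
  hasWeight_unitaryMonomial (hasWeight_rotation θ) k

/-- Continuous functionals agreeing on `1` and vanishing on elements of nonzero weight agree. -/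
lemma functional_ext {φ ψ : RotationAlgebra θ →L[ℂ] ℂ} (h1 : φ 1 = ψ 1)
    (hφ : ∀ (k : Fin 2 → ℤ) x, HasWeight (gaugeUnitary θ) (Circle.exp (2 * Real.pi * θ)) k x →
      k ≠ 0 → φ x = 0)
    (hψ : ∀ (k : Fin 2 → ℤ) x, HasWeight (gaugeUnitary θ) (Circle.exp (2 * Real.pi * θ)) k x →
      k ≠ 0 → ψ x = 0) : φ = ψ := by
  refine ContinuousLinearMap.ext_on
    (Submodule.dense_iff_topologicalClosure_eq_top.2
      (span_unitaryMonomial_dense (Θ := rotationMatrix θ))) ?_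
  rintro _ ⟨k, rfl⟩
  by_cases hk : k = 0
  · subst hk
    have : unitaryMonomial (u (rotationMatrix θ)) 0 = 1 := by
      simp [unitaryMonomial, listMonomial]
    simpa [this] using h1
  · exact (hφ k _ (hasWeight_monomial k) hk).trans (hψ k _ (hasWeight_monomial k) hk).symm

/-- A trace is invariant under inner automorphisms, so φ(x) = λ^(k j) φ(x), and λ^(k j) ≠ 1 for some
j. -/
lemma apply_eq_zero_of_tracial (hθ : Irrational θ) {φ : RotationAlgebra θ →L[ℂ] ℂ}
    (hφ : ∀ a b, φ (a * b) = φ (b * a)) (k : Fin 2 → ℤ) (x : RotationAlgebra θ)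
    (hx : HasWeight (gaugeUnitary θ) (Circle.exp (2 * Real.pi * θ)) k x) (hk : k ≠ 0) :
    φ x = 0 := by
  obtain ⟨j, hj⟩ := Function.ne_iff.1 hk
  have h := congrArg φ (hx j)
  rw [mul_assoc, hφ, mul_assoc, Unitary.coe_star_mul_self, mul_one, map_smul, smul_eq_mul] at h
  by_contra h0
  refine hj (circleExp_zpow_eq_one hθ (Circle.coe_eq_one.1 ?_))
  exact mul_right_cancel₀ h0 (by rw [← h, one_mul])

/-- Composing φ with a gauge automorphism changes neither its value at 1 nor its vanishing on
nonzero weights, so φ is invariant. Thus the gauge unitaries and their adjoints can be cycled under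
φ. Elements with this property form a closed subspace stable under products, and the gauge unitaries
are V* and U. -/
lemma tracial_of_apply_eq_zero {φ : RotationAlgebra θ →L[ℂ] ℂ}
    (hφ : ∀ (k : Fin 2 → ℤ) x, HasWeight (gaugeUnitary θ) (Circle.exp (2 * Real.pi * θ)) k x →
      k ≠ 0 → φ x = 0) (a b : RotationAlgebra θ) : φ (a * b) = φ (b * a) := by
  have hinv : ∀ j x, φ ((gaugeUnitary θ j : RotationAlgebra θ) * x) = φ (x * gaugeUnitary θ j) := by
    intro j x
    let ψ : RotationAlgebra θ →L[ℂ] ℂ := φ.comp (ContinuousLinearMap.mulLeftRight ℂ _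
      (gaugeUnitary θ j : RotationAlgebra θ) (star (gaugeUnitary θ j : RotationAlgebra θ)))
    have hψ : ∀ x, ψ x = φ ((gaugeUnitary θ j : RotationAlgebra θ) * x *
        star (gaugeUnitary θ j : RotationAlgebra θ)) := fun x => by
      simp [ψ, ContinuousLinearMap.mulLeftRight_apply]
    have heq : ψ = φ := functional_ext (by rw [hψ]; simp) (fun k x hx hk => by
      rw [hψ, hx j, map_smul, hφ k x hx hk, smul_zero]) hφ
    have h := hψ (x * gaugeUnitary θ j)
    rw [heq, mul_assoc, mul_assoc,
      Unitary.mul_star_self_of_mem (gaugeUnitary θ j).2, mul_one] at h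
    exact h.symm
  have hinv' : ∀ j x, φ (star (gaugeUnitary θ j : RotationAlgebra θ) * x) =
      φ (x * star (gaugeUnitary θ j : RotationAlgebra θ)) := by
    intro j x
    have h := hinv j (star (gaugeUnitary θ j : RotationAlgebra θ) * x *
      star (gaugeUnitary θ j : RotationAlgebra θ))
    rw [← mul_assoc, ← mul_assoc, Unitary.mul_star_self_of_mem (gaugeUnitary θ j).2, one_mul, mul_assoc _ _
      (gaugeUnitary θ j : RotationAlgebra θ), Unitary.coe_star_mul_self, mul_one] at h
    exact h.symm
  let S : Submodule ℂ (RotationAlgebra θ) :=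
    { carrier := {a | ∀ b, φ (a * b) = φ (b * a)}
      add_mem' := fun {x y} hx hy b => by rw [add_mul, mul_add, map_add, map_add, hx, hy]
      zero_mem' := fun b => by simp
      smul_mem' := fun c x hx b => by rw [smul_mul_assoc, mul_smul_comm, map_smul, map_smul, hx] }
  have hmul : ∀ x ∈ S, ∀ a ∈ S, x * a ∈ S := fun x hx a ha b => by
    rw [mul_assoc, hx, mul_assoc, ha, mul_assoc]
  have hgen : ∀ j, Univ.gen (ncTorusPresentation (rotationMatrix θ)) j ∈ S ∧
      star (Univ.gen (ncTorusPresentation (rotationMatrix θ)) j) ∈ S := by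
    intro j
    fin_cases j
    · exact ⟨hinv 1, hinv' 1⟩
    -- The gauge unitary of index 0 is V*, so the roles of generator and adjoint are interchanged.
    · refine ⟨fun b => ?_, hinv 0⟩
      have := hinv' 0 b
      rwa [show star (gaugeUnitary θ 0 : RotationAlgebra θ) =
        Univ.gen (ncTorusPresentation (rotationMatrix θ)) 1 from star_star _] at this
  have htop := Univ.topologicalClosure_eq_top (S := S) (fun b => by simp)
    (fun j a ha => hmul _ (hgen j).1 a ha) (fun j a ha => hmul _ (hgen j).2 a ha)
  have hclosed : IsClosed (S : Set (RotationAlgebra θ)) := by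
    have : (S : Set (RotationAlgebra θ)) = ⋂ b, {a | φ (a * b) = φ (b * a)} := by
      ext a; simp [S]
    rw [this]
    exact isClosed_iInter fun b => isClosed_eq (by fun_prop) (by fun_prop)
  rw [IsClosed.submodule_topologicalClosure_eq hclosed] at htop
  exact (htop ▸ Submodule.mem_top : a ∈ S) b

/-- A positive functional as a continuous functional. -/
def toCLM {A : Type} [CStarAlgebra A] [PartialOrder A] [StarOrderedRing A] (τ : A →ₚ[ℂ] ℂ) :
    A →L[ℂ] ℂ := ⟨τ.toLinearMap, map_continuous τ⟩

/-- The irrational rotation algebra has exactly one faithful normalized trace. -/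
lemma existsUnique_trace (hθ : Irrational θ) :
    ∃! τ : RotationAlgebra θ →ₚ[ℂ] ℂ, IsFaithfulTrace τ := by
  obtain ⟨φ, hφn, hφ1, hφ⟩ := exists_invariant_functional (gaugeUnitary θ)
    (fun _ => circleExp_zpow_eq_one hθ)
  let τ : RotationAlgebra θ →ₚ[ℂ] ℂ :=
    PositiveLinearMap.mk₀ φ.toLinearMap fun a ha => nonneg_of_norm_le_one hφn hφ1 ha
  have hτ : ∀ a, τ a = φ a := fun _ => rfl
  have htr : ∀ a b, φ (a * b) = φ (b * a) := tracial_of_apply_eq_zero hφ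
  refine ⟨τ, ⟨hφ1, htr, fun a ha => ?_⟩, fun τ' hτ' => ?_⟩
  · refine eq_zero_of_fourierCoeff_eq_zero (fun _ => circleExp_zpow_eq_one hθ)
      hasWeight_monomial (fun _ => Unitary.coe_mul_star_self _) span_unitaryMonomial_dense hφ1 hφ
      fun k => ?_
    -- By traciality the Fourier coefficient is the GNS inner product of the monomial with `a`,
    -- which Cauchy–Schwarz kills because `a` has seminorm zero.
    rw [htr, ← norm_eq_zero]
    refine le_antisymm ?_ (norm_nonneg _)
    have h := norm_inner_le_norm (𝕜 := ℂ)
      (τ.toPreGNS (unitaryMonomial (u (rotationMatrix θ)) k : RotationAlgebra θ)) (τ.toPreGNS a)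
    have h0 : ‖τ.toPreGNS a‖ = 0 := by
      rw [PositiveLinearMap.preGNS_norm_def, PositiveLinearMap.ofPreGNS_toPreGNS, ha]
      simp
    rw [h0, mul_zero] at h
    exact h
  · have heq : toCLM τ' = φ := functional_ext (hτ'.normalized.trans hφ1.symm)
      (apply_eq_zero_of_tracial hθ hτ'.tracial) hφ
    ext a
    exact congrArg (fun f : RotationAlgebra θ →L[ℂ] ℂ => f a) heq

end RotationAlgebra

/-! ## Operators on a Hilbert tensor product -/

section OpTensor

variable {H K : Type} [NormedAddCommGroup H] [InnerProductSpace ℂ H]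
  [NormedAddCommGroup K] [InnerProductSpace ℂ K]

/-- The inclusion of the algebraic tensor product. -/
def HilbertTensor.ofTensor (x : H ⊗[ℂ] K) : HilbertTensor H K := (x : Completion (H ⊗[ℂ] K))

lemma HilbertTensor.denseRange_ofTensor : DenseRange (HilbertTensor.ofTensor (H := H) (K := K)) :=
  Completion.denseRange_coe

lemma HilbertTensor.inner_ofTensor (x y : H ⊗[ℂ] K) :
    inner ℂ (HilbertTensor.ofTensor x) (HilbertTensor.ofTensor y) = inner ℂ x y :=
  Completion.inner_coe x y

lemma HilbertTensor.ofTensor_smul (c : ℂ) (x : H ⊗[ℂ] K) :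
    HilbertTensor.ofTensor (c • x) = c • HilbertTensor.ofTensor x := Completion.coe_smul c x

lemma opTensor_ofTensor (S : H →L[ℂ] H) (T : K →L[ℂ] K) (x : H ⊗[ℂ] K) :
    opTensor S T (HilbertTensor.ofTensor x) =
      HilbertTensor.ofTensor (TensorProduct.mapL S T x) :=
  ContinuousLinearMap.completion_apply_coe _ _

lemma HilbertTensor.clm_ext {S T : HilbertTensor H K →L[ℂ] HilbertTensor H K}
    (h : ∀ x, S (HilbertTensor.ofTensor x) = T (HilbertTensor.ofTensor x)) : S = T := by
  refine DFunLike.coe_injective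
    (HilbertTensor.denseRange_ofTensor.equalizer S.continuous T.continuous (funext h))

lemma opTensor_one : opTensor (1 : H →L[ℂ] H) (1 : K →L[ℂ] K) = 1 :=
  HilbertTensor.clm_ext fun x => by
    rw [opTensor_ofTensor, ContinuousLinearMap.one_def, ContinuousLinearMap.one_def,
      TensorProduct.mapL_id_id]
    rfl

lemma opTensor_mul (S S' : H →L[ℂ] H) (T T' : K →L[ℂ] K) :
    opTensor S T * opTensor S' T' = opTensor (S * S') (T * T') :=
  HilbertTensor.clm_ext fun x => by
    rw [opTensor_ofTensor, TensorProduct.mapL_mul, mul_apply_eq_comp,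
      opTensor_ofTensor, opTensor_ofTensor]
    rfl

lemma opTensor_smul_left (c : ℂ) (S : H →L[ℂ] H) (T : K →L[ℂ] K) :
    opTensor (c • S) T = c • opTensor S T :=
  HilbertTensor.clm_ext fun x => by
    rw [opTensor_ofTensor, TensorProduct.mapL_smul_left, smul_apply,
      smul_apply, opTensor_ofTensor, HilbertTensor.ofTensor_smul]

lemma opTensor_smul_right (c : ℂ) (S : H →L[ℂ] H) (T : K →L[ℂ] K) :
    opTensor S (c • T) = c • opTensor S T :=
  HilbertTensor.clm_ext fun x => by
    rw [opTensor_ofTensor, TensorProduct.mapL_smul_right, smul_apply,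
      smul_apply, opTensor_ofTensor, HilbertTensor.ofTensor_smul]

lemma opTensor_one_right_mul {S S' : H →L[ℂ] H} {c : ℂ} (h : S * S' = c • (S' * S)) :
    opTensor S (1 : K →L[ℂ] K) * opTensor S' 1 =
      c • (opTensor S' (1 : K →L[ℂ] K) * opTensor S 1) := by
  rw [opTensor_mul, opTensor_mul, h, opTensor_smul_left]

lemma opTensor_one_left_mul {T T' : K →L[ℂ] K} {c : ℂ} (h : T * T' = c • (T' * T)) :
    opTensor (1 : H →L[ℂ] H) T * opTensor 1 T' =
      c • (opTensor (1 : H →L[ℂ] H) T' * opTensor 1 T) := by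
  rw [opTensor_mul, opTensor_mul, h, opTensor_smul_right]

lemma opTensor_commute (S : H →L[ℂ] H) (T : K →L[ℂ] K) :
    opTensor S 1 * opTensor 1 T = opTensor 1 T * opTensor S 1 := by
  rw [opTensor_mul, opTensor_mul, one_mul, mul_one, one_mul, mul_one]

lemma inner_mapL_left [CompleteSpace H] [CompleteSpace K] (S : H →L[ℂ] H) (T : K →L[ℂ] K)
    (x y : H ⊗[ℂ] K) :
    inner ℂ (TensorProduct.mapL (star S) (star T) x) y =
      inner ℂ x (TensorProduct.mapL S T y) := by
  induction x with
  | zero => simp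
  | add x x' hx hx' => rw [map_add, inner_add_left, inner_add_left, hx, hx']
  | tmul a b =>
    induction y with
    | zero => simp
    | add y y' hy hy' => rw [map_add, inner_add_right, inner_add_right, hy, hy']
    | tmul c d =>
      rw [TensorProduct.mapL_tmul, TensorProduct.mapL_tmul, TensorProduct.inner_tmul,
        TensorProduct.inner_tmul, ContinuousLinearMap.star_eq_adjoint,
        ContinuousLinearMap.star_eq_adjoint, ContinuousLinearMap.adjoint_inner_left,
        ContinuousLinearMap.adjoint_inner_left]

lemma star_opTensor [CompleteSpace H] [CompleteSpace K] (S : H →L[ℂ] H) (T : K →L[ℂ] K) :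
    star (opTensor S T) = opTensor (star S) (star T) := by
  rw [ContinuousLinearMap.star_eq_adjoint (opTensor S T)]
  symm
  rw [ContinuousLinearMap.eq_adjoint_iff]
  intro x y
  refine HilbertTensor.denseRange_ofTensor.induction_on₂
    (p := fun x y => inner ℂ (opTensor (star S) (star T) x) y = inner ℂ x (opTensor S T y))
    (isClosed_eq (by fun_prop) (by fun_prop)) (fun x y => ?_) x y
  rw [opTensor_ofTensor, opTensor_ofTensor, HilbertTensor.inner_ofTensor,
    HilbertTensor.inner_ofTensor, inner_mapL_left]

lemma HilbertTensor.nontrivial [Nontrivial H] [Nontrivial K] :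
    Nontrivial (HilbertTensor H K) := by
  obtain ⟨x, hx⟩ := exists_ne (0 : H)
  obtain ⟨y, hy⟩ := exists_ne (0 : K)
  refine ⟨⟨HilbertTensor.ofTensor (x ⊗ₜ y), 0, fun h => ?_⟩⟩
  have h1 := HilbertTensor.inner_ofTensor (x ⊗ₜ[ℂ] y) (x ⊗ₜ y)
  rw [h, inner_zero_left, TensorProduct.inner_tmul, eq_comm, mul_eq_zero, inner_self_eq_zero,
    inner_self_eq_zero] at h1
  exact h1.elim hx hy

variable [CompleteSpace H] [CompleteSpace K]

variable (K) in
/-- The unitary `S ⊗ 1`. -/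
def unitaryTensorOne (S : unitary (H →L[ℂ] H)) :
    unitary (HilbertTensor H K →L[ℂ] HilbertTensor H K) :=
  ⟨opTensor S 1, by
    constructor <;>
    rw [star_opTensor, opTensor_mul, star_one, one_mul] <;>
    simp [opTensor_one]⟩

variable (H) in
/-- The unitary `1 ⊗ T`. -/
def oneTensorUnitary (T : unitary (K →L[ℂ] K)) :
    unitary (HilbertTensor H K →L[ℂ] HilbertTensor H K) :=
  ⟨opTensor 1 T, by
    constructor <;>
    rw [star_opTensor, opTensor_mul, star_one, one_mul] <;>
    simp [opTensor_one]⟩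

end OpTensor

/-! ## Left and right multiplication -/

section Mul

variable {A : Type} [CStarAlgebra A] [PartialOrder A] [StarOrderedRing A] {τ : A →ₚ[ℂ] ℂ}

lemma rightMul_coe (hτ : IsFaithfulTrace τ) (b : A) (x : τ.PreGNS) :
    rightMul hτ b (x : τ.GNS) = ((τ.toPreGNS (τ.ofPreGNS x * b) : τ.PreGNS) : τ.GNS) :=
  ContinuousLinearMap.completion_apply_coe _ _

lemma gns_clm_ext {S T : τ.GNS →L[ℂ] τ.GNS} (h : ∀ x : τ.PreGNS, S (x : τ.GNS) = T (x : τ.GNS)) :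
    S = T :=
  DFunLike.coe_injective
    (Completion.denseRange_coe.equalizer S.continuous T.continuous (funext h))

lemma rightMul_one (hτ : IsFaithfulTrace τ) : rightMul hτ 1 = 1 :=
  gns_clm_ext fun x => by rw [rightMul_coe, mul_one]; rfl

lemma rightMul_mul (hτ : IsFaithfulTrace τ) (a b : A) :
    rightMul hτ a * rightMul hτ b = rightMul hτ (b * a) :=
  gns_clm_ext fun x => by
    rw [mul_apply_eq_comp, rightMul_coe, rightMul_coe, rightMul_coe,
      PositiveLinearMap.ofPreGNS_toPreGNS, mul_assoc]

lemma rightMul_smul (hτ : IsFaithfulTrace τ) (c : ℂ) (a : A) :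
    rightMul hτ (c • a) = c • rightMul hτ a :=
  gns_clm_ext fun x => by
    rw [smul_apply, rightMul_coe, rightMul_coe, mul_smul_comm, map_smul,
      Completion.coe_smul]

lemma rightMul_mul_of_mul_eq (hτ : IsFaithfulTrace τ) {a b : A} {c : ℂ} (h : a * b = c • (b * a)) :
    rightMul hτ b * rightMul hτ a = c • (rightMul hτ a * rightMul hτ b) := by
  rw [rightMul_mul, rightMul_mul, h, rightMul_smul]

lemma leftMul_mul_of_mul_eq {a b : A} {c : ℂ} (h : a * b = c • (b * a)) :
    leftMul τ a * leftMul τ b = c • (leftMul τ b * leftMul τ a) := by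
  simp only [leftMul]
  rw [← map_mul, h, map_smul, map_mul]

/-- This is where traciality enters: τ(a x* y) = τ(x* y a). -/
lemma star_rightMul (hτ : IsFaithfulTrace τ) (a : A) :
    star (rightMul hτ a) = rightMul hτ (star a) := by
  rw [ContinuousLinearMap.star_eq_adjoint]
  symm
  rw [ContinuousLinearMap.eq_adjoint_iff]
  intro x y
  induction x, y using Completion.induction_on₂ with
  | hp => apply isClosed_eq <;> fun_prop
  | ih x y =>
    rw [rightMul_coe, rightMul_coe, Completion.inner_coe, Completion.inner_coe,
      PositiveLinearMap.preGNS_inner_def, PositiveLinearMap.preGNS_inner_def,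
      PositiveLinearMap.ofPreGNS_toPreGNS, PositiveLinearMap.ofPreGNS_toPreGNS, star_mul,
      star_star, mul_assoc, hτ.tracial, mul_assoc]

variable (τ) in
/-- Left multiplication by a unitary. -/
def leftMulUnitary (a : unitary A) : unitary (τ.GNS →L[ℂ] τ.GNS) :=
  ⟨leftMul τ a, Unitary.map_mem τ.gnsStarAlgHom a.2⟩

/-- Right multiplication by a unitary. -/
def rightMulUnitary (hτ : IsFaithfulTrace τ) (a : unitary A) : unitary (τ.GNS →L[ℂ] τ.GNS) :=
  ⟨rightMul hτ a, by
    constructor <;> rw [star_rightMul, rightMul_mul] <;> simp [rightMul_one]⟩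

lemma gns_nontrivial (hτ : IsFaithfulTrace τ) : Nontrivial τ.GNS := by
  refine ⟨⟨((τ.toPreGNS 1 : τ.PreGNS) : τ.GNS), 0, fun h => ?_⟩⟩
  have h1 := Completion.inner_coe (τ.toPreGNS 1) (τ.toPreGNS 1) (𝕜 := ℂ)
  rw [h, inner_zero_left, PositiveLinearMap.preGNS_inner_def, PositiveLinearMap.ofPreGNS_toPreGNS,
    star_one, one_mul, hτ.normalized] at h1
  exact zero_ne_one h1

end Mul

/-- A `C*`-algebra is isomorphic to its image under an injective `*`-homomorphism. -/
lemma nonempty_equiv_of_range_eq {A B : Type} [CStarAlgebra A] [CStarAlgebra B] {π : A →⋆ₐ[ℂ] B}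
    (hπ : Function.Injective π) {S : StarSubalgebra ℂ B} (h : π.range = S) :
    Nonempty (S ≃⋆ₐ[ℂ] A) := by
  subst h
  exact ⟨(StarAlgEquiv.ofInjective π hπ).symm⟩

/-! ## The bimodule algebra -/

section Bimodule

open NCTorus

variable {θ : ℝ} {τ : RotationAlgebra θ →ₚ[ℂ] ℂ} (hτ : IsFaithfulTrace τ)

/-- The generators of the bimodule algebra, ordered so as to satisfy the relations of the
noncommutative torus. -/
def bimoduleUnitary : Fin 4 → unitary (HilbertTensor τ.GNS τ.GNS →L[ℂ] HilbertTensor τ.GNS τ.GNS) :=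
  ![unitaryTensorOne _ (leftMulUnitary τ (u (rotationMatrix θ) 0)),
    unitaryTensorOne _ (leftMulUnitary τ (u (rotationMatrix θ) 1)),
    oneTensorUnitary _ (rightMulUnitary hτ (u (rotationMatrix θ) 1)),
    oneTensorUnitary _ (rightMulUnitary hτ (u (rotationMatrix θ) 0))]

/-- Right multiplication reverses products, so UV = λVU becomes V_r U_r = λ U_r V_r. Listing V_r
before U_r therefore gives +θ in the second block as well. -/
lemma bimoduleUnitary_mul (j k : Fin 4) :
    (bimoduleUnitary hτ j : HilbertTensor τ.GNS τ.GNS →L[ℂ] HilbertTensor τ.GNS τ.GNS) *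
      bimoduleUnitary hτ k =
      Complex.exp (2 * Real.pi * Complex.I * doubleRotationMatrix θ j k) •
        ((bimoduleUnitary hτ k : HilbertTensor τ.GNS τ.GNS →L[ℂ] HilbertTensor τ.GNS τ.GNS) *
          bimoduleUnitary hτ j) := by
  have hu : (u (rotationMatrix θ) 0 : RotationAlgebra θ) * u (rotationMatrix θ) 1 =
      (Circle.exp (2 * Real.pi * θ) : ℂ) •
        ((u (rotationMatrix θ) 1 : RotationAlgebra θ) * u (rotationMatrix θ) 0) := by
    rw [← exp_eq_coe_circleExp]
    exact u_mul_u (rotationMatrix θ) 0 1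
  refine doubleRotation_relations (bimoduleUnitary hτ)
    (opTensor_one_right_mul ?_) (opTensor_one_left_mul ?_)
    (opTensor_commute _ _) (opTensor_commute _ _) (opTensor_commute _ _) (opTensor_commute _ _) j k
  · exact leftMul_mul_of_mul_eq hu
  · exact rightMul_mul_of_mul_eq hτ hu

/-- The bimodule algebra is isomorphic to the four-dimensional noncommutative torus. -/
lemma exists_bimoduleAlgebra_equiv_ncTorus (hθ : Irrational θ) :
    Nonempty (bimoduleAlgebra hτ ≃⋆ₐ[ℂ] NCTorus (doubleRotationMatrix θ)) := by
  have := gns_nontrivial hτ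
  have := HilbertTensor.nontrivial (H := τ.GNS) (K := τ.GNS)
  -- Nontriviality of the Hilbert space makes the target algebra nonzero, so simplicity applies to
  -- this homomorphism.
  refine (NCTorus.exists_lift (Θ := doubleRotationMatrix θ) (bimoduleUnitary hτ)
    (bimoduleUnitary_mul hτ)).elim fun π hπ => ?_
  have hinj := NCTorus.injective_doubleRotation hθ π
  refine nonempty_equiv_of_range_eq hinj
    (NCTorus.range_eq_topologicalClosure_adjoin hinj (Set.Subset.antisymm ?_ ?_))
  · rintro x (rfl | rfl | rfl | rfl)
    · exact ⟨0, hπ 0⟩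
    · exact ⟨1, hπ 1⟩
    · exact ⟨3, hπ 3⟩
    · exact ⟨2, hπ 2⟩
  · rintro _ ⟨j, rfl⟩
    fin_cases j
    · exact Or.inl (hπ 0)
    · exact Or.inr (Or.inl (hπ 1))
    · exact Or.inr (Or.inr (Or.inr (hπ 2)))
    · exact Or.inr (Or.inr (Or.inl (hπ 3)))

end Bimodule

end

theorem mainTheorem7 (θ : ℝ) (hθ : Irrational θ) :
    (∃! τ : RotationAlgebra θ →ₚ[ℂ] ℂ, IsFaithfulTrace τ) ∧
    ∀ (τ : RotationAlgebra θ →ₚ[ℂ] ℂ) (hτ : IsFaithfulTrace τ),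
      Nonempty (bimoduleAlgebra hτ ≃⋆ₐ[ℂ] CrossedProduct (doubleRotation θ)) ∧
      Nonempty (bimoduleAlgebra hτ ≃⋆ₐ[ℂ]
        NCTorus !![0, θ, 0, 0; -θ, 0, 0, 0; 0, 0, 0, θ; 0, 0, -θ, 0]) := by
  refine ⟨RotationAlgebra.existsUnique_trace hθ, fun τ hτ => ?_⟩
  exact (exists_bimoduleAlgebra_equiv_ncTorus hτ hθ).elim fun e =>
    (exists_ncTorus_equiv_crossedProduct hθ).elim fun f => ⟨⟨e.trans f⟩, ⟨e⟩⟩
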